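/- Consider the scale mixture of skew-normal linear mixed model for one subject with $n\ge 1$ observations, $l$ fixed and $q$ random effects. Let $X\in\mathbb R^{n\times l}$, $Z\in\mathbb R^{n\times q}$, $\beta\in\mathbb R^l$, $\lambda\in\mathbb R^q$, $\Sigma=\sigma_e^2R$ with $\sigma_e^2>0$ and $R\in\mathbb R^{n\times n}$ symmetric positive definite, $D\in\mathbb R^{q\times q}$ symmetric positive definite, and let $H$ be a probability distribution on $(0,\infty)$ with $k_1=\int u^{-1/2}\,dH(u)<\infty$. Powers $^{\pm1/2}$ of positive definite matrices denote the symmetric positive definite ones. Put $$c=-\sqrt{2/\pi}\,k_1,\quad \delta=\frac{\lambda}{\sqrt{1+\lambda^\top\lambda}},\quad \Delta=D^{1/2}\delta,\quad \Gamma=D-\Delta\Delta^\top .$$ Let $TN(m,v;I)$ be the normal distribution $N(m,v)$ truncated to (conditioned on) $I$. Let $U,T$ be real-valued and $b,Y$ be $\mathbb R^q$- and $\mathbb R^n$-valued random variables on one probability space with $$U\sim H,\qquad T\mid U=u\sim TN(c,u^{-1};(c,\infty)),\qquad b\mid T=t,U=u\sim N_q(\Delta t,u^{-1}\Gamma),$$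 $$Y\mid b,T,U=u\sim N_n(X\beta+Zb,u^{-1}\Sigma).$$ Define $\Omega=\Sigma+Z\Gamma Z^\top$, $\Psi=\Sigma+ZDZ^\top$, $M=(1+\Delta^\top Z^\top\Omega^{-1}Z\Delta)^{-1/2}$, $B=(\Gamma^{-1}+Z^\top\Sigma^{-1}Z)^{-1}$, $s=(I_q-BZ^\top\Sigma^{-1}Z)\Delta$ and, for $y\in\mathbb R^n$, $\mu=\mu(y)=M^2\Delta^\top Z^\top\Omega^{-1}(y-X\beta-cZ\Delta)$, $r=r(y)=BZ^\top\Sigma^{-1}(y-X\beta)$, $A=A(y)=\mu/M$. Further let $\zeta=D^{-1/2}\lambda$, $\Lambda=(D^{-1}+Z^\top\Sigma^{-1}Z)^{-1}$ and $\bar\lambda=\Psi^{-1/2}ZD\zeta/\sqrt{1+\zeta^\top\Lambda\zeta}$. Let $\Phi$ and $\phi_1$ be the standard normal cdf and pdf, $W_\Phi=\phi_1/\Phi$, and let $\phi_n(\cdot\,;m,S)$ be the density of $N_n(m,S)$. Then: 1. $b\mid T=t,U=u,Y=y\ \sim\ N_q(s\,t+r,\;u^{-1}B)$. 2. $T\mid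 U=u,Y=y\ \sim\ TN(c+\mu,\;u^{-1}M^2;\;(c,\infty))$. 3. $Y\sim \mathrm{SMSN}_n(X\beta+cZ\Delta,\Psi,\bar\lambda;H)$, i.e. $Y$ has the density $$y\mapsto 2\int_0^\infty\phi_n(y;X\beta+cZ\Delta,u^{-1}\Psi)\,\Phi\big(u^{1/2}\bar\lambda^\top\Psi^{-1/2}(y-X\beta-cZ\Delta)\big)\,dH(u).$$ 4. $A(y)=\bar\lambda^\top\Psi^{-1/2}(y-X\beta-cZ\Delta)$ for all $y\in\mathbb R^n$. 5. For almost every $y$ (with respect to the law of $Y$) the conditional expectations given $Y=y$ $$\hat u=E[U\mid y],\quad \widehat{ut}=E[UT\mid y],\quad \widehat{ut^2}=E[UT^2\mid y],\quad \widehat{ub}=E[Ub\mid y],\quad \widehat{utb}=E[UTb\mid y],$$ $$\widehat{ub^2}=E[Ubb^\top\mid y],\qquad \hat\tau_1=E[U^{1/2}W_\Phi(U^{1/2}A)\mid y]$$ (integrals with respect to the regular conditional distribution of $(U,T,b)$ given $Y=y$) exist and are finite, and $$\widehat{ut}=(\mu+c)\hat u+M\hat\tau_1,\qquad \widehat{ut^2}=M^2+(\mu+c)^2\hat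 u+M(\mu+2c)\hat\tau_1,$$ $$\widehat{ub}=r\,\hat u+s\,\widehat{ut},\qquad \widehat{utb}=r\,\widehat{ut}+s\,\widehat{ut^2},$$ $$\widehat{ub^2}=B+\hat u\,rr^\top+\widehat{ut}\,(sr^\top+rs^\top)+\widehat{ut^2}\,ss^\top .$$ Statements about conditional distributions hold for almost every value of the conditioning variables. -/

import Mathlib

open MeasureTheory ProbabilityTheory Set
open scoped Matrix MatrixOrder

noncomputable section

/-! ### Distributions -/

/-- The regular conditional distribution of `V` given `W = w` is `κ w`, for almost every value `w`
of `W`. -/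
def CondLaw {Ω S E : Type*} [MeasurableSpace Ω] [MeasurableSpace S] [MeasurableSpace E]
    [StandardBorelSpace E] [Nonempty E] (V : Ω → E) (W : Ω → S) (P : Measure Ω)
    [IsFiniteMeasure P] (κ : S → Measure E) : Prop :=
  ∀ᵐ w ∂(P.map W), condDistrib V W P w = κ w

/-- `TN(m, v; I)`: the normal distribution with mean `m` and variance `v`, truncated to `I`
(that is, conditioned on `I`). -/
def truncNormal (m v : ℝ) (I : Set ℝ) : Measure ℝ :=
  ProbabilityTheory.cond (gaussianReal m v.toNNReal) I

/-- Density of the `p`-variate normal distribution with mean `m` and covariance matrix `S`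
(for positive definite `S`). -/
def normalPDF {p : ℕ} (m : Fin p → ℝ) (S : Matrix (Fin p) (Fin p) ℝ) (y : Fin p → ℝ) : ℝ :=
  (Real.sqrt ((2 * Real.pi) ^ p * S.det))⁻¹ * Real.exp (-((y - m) ⬝ᵥ (S⁻¹ *ᵥ (y - m))) / 2)

/-- Standard normal cumulative distribution function. -/
def stdNormalCDF (x : ℝ) : ℝ := cdf (gaussianReal 0 1) x

/-- `W_Φ(x) = φ₁(x) / Φ(x)`. -/
def WPhi (x : ℝ) : ℝ := gaussianPDFReal 0 1 x / stdNormalCDF x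

/-- Density of the scale mixture of skew-normal distributions `SMSN_p(m, S, lam; H)` with weight
function `κ(u) = u⁻¹`; it may take the value `∞` on a null set. -/
def smsnPDF {p : ℕ} (m : Fin p → ℝ) (S : Matrix (Fin p) (Fin p) ℝ) (lam : Fin p → ℝ)
    (H : Measure ℝ) (y : Fin p → ℝ) : ENNReal :=
  2 * ∫⁻ u in Ioi (0 : ℝ), ENNReal.ofReal
    (normalPDF m (u⁻¹ • S) y *
      stdNormalCDF (Real.sqrt u * (lam ⬝ᵥ ((CFC.sqrt S)⁻¹ *ᵥ (y - m))))) ∂H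

/-- The distribution `SMSN_p(m, S, lam; H)`. -/
def smsn {p : ℕ} (m : Fin p → ℝ) (S : Matrix (Fin p) (Fin p) ℝ) (lam : Fin p → ℝ)
    (H : Measure ℝ) : Measure (EuclideanSpace ℝ (Fin p)) :=
  volume.withDensity fun y => smsnPDF m S lam H y.ofLp

/-! ### The linear mixed model of one subject -/

/-- Design matrices and parameters of the scale mixture of skew-normal linear mixed model, for one
subject with `n` observations, `l` fixed effects and `q` random effects. `H` is the distribution of
the mixing variable; `integrable_k1` says that `k₁ = E[U^{-1/2}]`, hence `c`, is finite. -/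
structure SMSNLMM (n l q : ℕ) where
  X : Matrix (Fin n) (Fin l) ℝ
  Z : Matrix (Fin n) (Fin q) ℝ
  β : Fin l → ℝ
  sigmaSq : ℝ
  sigmaSq_pos : 0 < sigmaSq
  R : Matrix (Fin n) (Fin n) ℝ
  R_posDef : R.PosDef
  D : Matrix (Fin q) (Fin q) ℝ
  D_posDef : D.PosDef
  lam : Fin q → ℝ
  H : Measure ℝ
  H_prob : IsProbabilityMeasure H
  H_pos : ∀ᵐ u ∂H, 0 < u
  integrable_k1 : Integrable (fun u : ℝ => u ^ (-(1 / 2) : ℝ)) H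

namespace SMSNLMM

variable {n l q : ℕ} (θ : SMSNLMM n l q)

/-- `Σ = σₑ² R`. -/
def Sig : Matrix (Fin n) (Fin n) ℝ := θ.sigmaSq • θ.R

/-- `k₁ = E[U^{-1/2}]`. -/
def k1 : ℝ := ∫ u, u ^ (-(1 / 2) : ℝ) ∂θ.H

/-- `c = -√(2/π) k₁`. -/
def c : ℝ := -Real.sqrt (2 / Real.pi) * θ.k1

/-- `δ = λ / √(1 + λᵀλ)`. -/
def delta : Fin q → ℝ := (Real.sqrt (1 + θ.lam ⬝ᵥ θ.lam))⁻¹ • θ.lam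

/-- `Δ = D^{1/2} δ`. -/
def Delta : Fin q → ℝ := CFC.sqrt θ.D *ᵥ θ.delta

/-- `Γ = D - Δ Δᵀ`. -/
def Gam : Matrix (Fin q) (Fin q) ℝ := θ.D - Matrix.vecMulVec θ.Delta θ.Delta

/-- `Ω = Σ + Z Γ Zᵀ`. -/
def Omega : Matrix (Fin n) (Fin n) ℝ := θ.Sig + θ.Z * θ.Gam * θ.Zᵀ

/-- `Ψ = Σ + Z D Zᵀ`. -/
def Psi : Matrix (Fin n) (Fin n) ℝ := θ.Sig + θ.Z * θ.D * θ.Zᵀ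

/-- `ζ = D^{-1/2} λ`. -/
def zeta : Fin q → ℝ := (CFC.sqrt θ.D)⁻¹ *ᵥ θ.lam

/-- `Λ = (D⁻¹ + Zᵀ Σ⁻¹ Z)⁻¹`. -/
def Lam : Matrix (Fin q) (Fin q) ℝ := (θ.D⁻¹ + θ.Zᵀ * θ.Sig⁻¹ * θ.Z)⁻¹

/-- `λ̄ = Ψ^{-1/2} Z D ζ / √(1 + ζᵀ Λ ζ)`. -/
def lamBar : Fin n → ℝ :=
  (Real.sqrt (1 + θ.zeta ⬝ᵥ (θ.Lam *ᵥ θ.zeta)))⁻¹ •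
    ((CFC.sqrt θ.Psi)⁻¹ *ᵥ (θ.Z *ᵥ (θ.D *ᵥ θ.zeta)))

/-- The location `X β + c Z Δ` of `Y`. -/
def loc : Fin n → ℝ := θ.X *ᵥ θ.β + θ.c • (θ.Z *ᵥ θ.Delta)

/-- `M = (1 + Δᵀ Zᵀ Ω⁻¹ Z Δ)^{-1/2}`. -/
def M : ℝ :=
  (1 + (θ.Z *ᵥ θ.Delta) ⬝ᵥ (θ.Omega⁻¹ *ᵥ (θ.Z *ᵥ θ.Delta))) ^ (-(1 / 2) : ℝ)

/-- `μ = M² Δᵀ Zᵀ Ω⁻¹ (y - X β - c Z Δ)`. -/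
def mu (y : Fin n → ℝ) : ℝ :=
  θ.M ^ 2 * ((θ.Z *ᵥ θ.Delta) ⬝ᵥ (θ.Omega⁻¹ *ᵥ (y - θ.loc)))

/-- `B = (Γ⁻¹ + Zᵀ Σ⁻¹ Z)⁻¹`. -/
def B : Matrix (Fin q) (Fin q) ℝ := (θ.Gam⁻¹ + θ.Zᵀ * θ.Sig⁻¹ * θ.Z)⁻¹

/-- `s = (I - B Zᵀ Σ⁻¹ Z) Δ`. -/
def s : Fin q → ℝ := (1 - θ.B * θ.Zᵀ * θ.Sig⁻¹ * θ.Z) *ᵥ θ.Delta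

/-- `r = B Zᵀ Σ⁻¹ (y - X β)`. -/
def r (y : Fin n → ℝ) : Fin q → ℝ := (θ.B * θ.Zᵀ * θ.Sig⁻¹) *ᵥ (y - θ.X *ᵥ θ.β)

/-- `A = μ / M`. -/
def A (y : Fin n → ℝ) : ℝ := θ.mu y / θ.M

/-- The hierarchical model: `U ∼ H`, `T | U = u ∼ TN(c, u⁻¹; (c, ∞))`,
`b | T = t, U = u ∼ N_q(Δ t, u⁻¹ Γ)` and `Y | b, T, U = u ∼ N_n(X β + Z b, u⁻¹ Σ)`. -/
structure IsModel {Ω : Type*} [MeasurableSpace Ω] (P : Measure Ω) [IsProbabilityMeasure P]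
    (U T : Ω → ℝ) (b : Ω → EuclideanSpace ℝ (Fin q)) (Y : Ω → EuclideanSpace ℝ (Fin n)) :
    Prop where
  measurable_U : Measurable U
  measurable_T : Measurable T
  measurable_b : Measurable b
  measurable_Y : Measurable Y
  law_U : P.map U = θ.H
  law_T : CondLaw T U P fun u => truncNormal θ.c u⁻¹ (Ioi θ.c)
  law_b : CondLaw b (fun ω => (T ω, U ω)) P fun w =>
    multivariateGaussian (WithLp.toLp 2 (w.1 • θ.Delta)) (w.2⁻¹ • θ.Gam)
  law_Y : CondLaw Y (fun ω => (b ω, T ω, U ω)) P fun w =>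
    multivariateGaussian (WithLp.toLp 2 (θ.X *ᵥ θ.β + θ.Z *ᵥ w.1.ofLp)) (w.2.2⁻¹ • θ.Sig)

end SMSNLMM

/-! ### Conditional moments given `Y = y`

Below, `Q` stands for the conditional distribution of `(U, T, b)` given `Y = y`. -/

section Moments

variable {q : ℕ}

/-- The conditional distribution of `(U, T, b)` given `Y = y`. -/
def condLatent {Ω : Type*} [MeasurableSpace Ω] {n : ℕ} (P : Measure Ω) [IsFiniteMeasure P]
    (U T : Ω → ℝ) (b : Ω → EuclideanSpace ℝ (Fin q)) (Y : Ω → EuclideanSpace ℝ (Fin n))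
    (y : EuclideanSpace ℝ (Fin n)) : Measure (ℝ × ℝ × EuclideanSpace ℝ (Fin q)) :=
  condDistrib (fun ω => (U ω, T ω, b ω)) Y P y

variable (Q : Measure (ℝ × ℝ × EuclideanSpace ℝ (Fin q)))

/-- `E[U | y]`. -/
def uHat : ℝ := ∫ z, z.1 ∂Q

/-- `E[U T | y]`. -/
def utHat : ℝ := ∫ z, z.1 * z.2.1 ∂Q

/-- `E[U T² | y]`. -/
def utSqHat : ℝ := ∫ z, z.1 * z.2.1 ^ 2 ∂Q

/-- `E[U b | y]`. -/
def ubHat : Fin q → ℝ := fun j => ∫ z, z.1 * z.2.2 j ∂Q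

/-- `E[U T b | y]`. -/
def utbHat : Fin q → ℝ := fun j => ∫ z, z.1 * z.2.1 * z.2.2 j ∂Q

/-- `E[U b bᵀ | y]`. -/
def ubbHat : Matrix (Fin q) (Fin q) ℝ :=
  Matrix.of fun j k => ∫ z, z.1 * (z.2.2 j * z.2.2 k) ∂Q

/-- `τ₁ = E[U^{1/2} W_Φ(U^{1/2} a) | y]`, to be taken at `a = A`. -/
def tauOneHat (a : ℝ) : ℝ := ∫ z, Real.sqrt z.1 * WPhi (Real.sqrt z.1 * a) ∂Q

end Moments

end

/-!
Bayes' rule is applied twice to densities conditional on the scale `U`. Completing the square, the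
product of the densities of `b` and of `Y` given `b` is the density of `Y` given `(T, U)` times a
normal density in `b`; and the product of the truncated normal density of `T` with the density of
`Y` given `(T, U)`, whose mean is affine in `T`, is the skew-normal density of `Y` given `U` times
a truncated normal density in `T`. Conditioning on `Y` first and on the remaining variables
afterwards turns the two posteriors into conditional distributions under the law of `(U, T, b)`
given `Y = y`, so that the moment formulas are those of a normal and of a truncated normal law.

`U` itself need not be integrable, so the posterior moments have to be seen to exist. The residuals
`√U (T - c)`, `√U (b - Δ T)` and `√U (Y - X β - Z b)` have constant conditional second moments given
`U`, hence are square integrable under the law given `Y = y`. Since `y - X β - c Z Δ` is a linear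
combination of the unnormalized residuals and is almost surely nonzero, `√U` is square integrable
given `Y = y`, and therefore so are `√U T` and `√U b`.
-/

/-! ### Conditional densities -/

section ConditionalDensity

open Function

variable {Ω S E F : Type*} [MeasurableSpace Ω] [MeasurableSpace S] [MeasurableSpace E]
  [MeasurableSpace F] {P : Measure Ω} {V : Ω → E} {W : Ω → S} {k : S → E → ℝ} {ν : Measure E}

/-- `k w` is, for almost every value `w` of `W`, a density with respect to `ν` of the conditional
distribution of `V` given `W = w`. It is stated as the disintegration of the joint law of `(W, V)`,
so that the order of conditioning can be exchanged without regular conditional distributions. -/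
def HasCondDensity (V : Ω → E) (W : Ω → S) (P : Measure Ω) (ν : Measure E) (k : S → E → ℝ) : Prop :=
  P.map (fun ω => (W ω, V ω)) =
    ((P.map W).prod ν).withDensity fun p => ENNReal.ofReal (k p.1 p.2)

theorem hasCondDensity_iff_lintegral [SFinite P] [SFinite ν] (hV : Measurable V) (hW : Measurable W)
    (hk : Measurable (uncurry k)) :
    HasCondDensity V W P ν k ↔ ∀ f : S × E → ENNReal, Measurable f →
      ∫⁻ ω, f (W ω, V ω) ∂P = ∫⁻ w, ∫⁻ v, ENNReal.ofReal (k w v) * f (w, v) ∂ν ∂(P.map W) := by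
  have hk' : Measurable fun p : S × E => ENNReal.ofReal (k p.1 p.2) := hk.ennreal_ofReal
  have joint (f : S × E → ENNReal) (hf : Measurable f) :
      ∫⁻ p, f p ∂(P.map fun ω => (W ω, V ω)) = ∫⁻ ω, f (W ω, V ω) ∂P :=
    lintegral_map hf (hW.prodMk hV)
  have iterated (f : S × E → ENNReal) (hf : Measurable f) :
      ∫⁻ p, f p ∂((P.map W).prod ν).withDensity (fun p => ENNReal.ofReal (k p.1 p.2)) =
        ∫⁻ w, ∫⁻ v, ENNReal.ofReal (k w v) * f (w, v) ∂ν ∂(P.map W) := by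
    rw [lintegral_withDensity_eq_lintegral_mul _ hk' hf,
      lintegral_prod _ (hk'.mul hf).aemeasurable]
    rfl
  refine ⟨fun h f hf => ?_, fun h => Measure.ext_of_lintegral _ fun f hf => ?_⟩
  · rw [← joint f hf, ← iterated f hf, h]
  · rw [joint f hf, iterated f hf, h f hf]

theorem HasCondDensity.map_eq_withDensity [SFinite P] [SFinite ν] (hV : Measurable V)
    (hW : Measurable W) (hk : Measurable (uncurry k)) (h : HasCondDensity V W P ν k) :
    P.map V = ν.withDensity fun v => ∫⁻ w, ENNReal.ofReal (k w v) ∂(P.map W) := by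
  have hk' : Measurable fun p : S × E => ENNReal.ofReal (k p.1 p.2) := hk.ennreal_ofReal
  have marginal_measurable : Measurable fun v => ∫⁻ w, ENNReal.ofReal (k w v) ∂(P.map W) :=
    hk'.lintegral_prod_left'
  refine Measure.ext_of_lintegral _ fun f hf => ?_
  rw [lintegral_map hf hV, (hasCondDensity_iff_lintegral hV hW hk).1 h (fun p => f p.2)
      (by fun_prop), lintegral_lintegral_swap (by fun_prop),
    lintegral_withDensity_eq_lintegral_mul _ marginal_measurable hf]
  exact lintegral_congr fun v => lintegral_mul_const (f v) <|
    show Measurable fun w => ENNReal.ofReal (k w v) by fun_prop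

section Bayes

variable {X : Ω → E} {Y : Ω → F} {μ : Measure E} {ν : Measure F} {f : S → E → ℝ}
  {k : E × S → F → ℝ} {g : S → F → ℝ} {h : S × F → E → ℝ}

theorem lintegral_eq_of_density_mul_eq [SFinite P] [SFinite μ] [SFinite ν]
    (hW : Measurable W) (hX : Measurable X) (hY : Measurable Y)
    (hf : Measurable (uncurry f)) (hk : Measurable (uncurry k)) (hh : Measurable (uncurry h))
    (hf0 : 0 ≤ f) (hg0 : 0 ≤ g)
    (hXW : HasCondDensity X W P μ f) (hYXW : HasCondDensity Y (fun ω => (X ω, W ω)) P ν k)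
    (hfk : ∀ᵐ w ∂(P.map W), ∀ x y, f w x * k (x, w) y = g w y * h (w, y) x)
    {F' : (S × F) × E → ENNReal} (hF : Measurable F') :
    ∫⁻ ω, F' ((W ω, Y ω), X ω) ∂P = ∫⁻ w, ∫⁻ y, ENNReal.ofReal (g w y) *
      ∫⁻ x, ENNReal.ofReal (h (w, y) x) * F' ((w, y), x) ∂μ ∂ν ∂(P.map W) := by
  have : Measurable fun p : S × E => ENNReal.ofReal (f p.1 p.2) := hf.ennreal_ofReal
  have : Measurable fun p : (E × S) × F => ENNReal.ofReal (k p.1 p.2) := hk.ennreal_ofReal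
  have : Measurable fun p : (S × F) × E => ENNReal.ofReal (h p.1 p.2) := hh.ennreal_ofReal
  rw [(hasCondDensity_iff_lintegral hY (hX.prodMk hW) hk).1 hYXW
      (fun p => F' ((p.1.2, p.2), p.1.1)) (by fun_prop),
    lintegral_map (Measurable.lintegral_prod_right' (f := fun p : (E × S) × F =>
      ENNReal.ofReal (k p.1 p.2) * F' ((p.1.2, p.2), p.1.1)) (by fun_prop)) (hX.prodMk hW),
    (hasCondDensity_iff_lintegral hX hW hf).1 hXW (fun p =>
      ∫⁻ y, ENNReal.ofReal (k (p.2, p.1) y) * F' ((p.1, y), p.2) ∂ν) (by fun_prop)]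
  refine lintegral_congr_ae ?_
  filter_upwards [hfk] with w hw
  simp_rw [← lintegral_const_mul' _ _ ENNReal.ofReal_ne_top]
  rw [lintegral_lintegral_swap (by fun_prop)]
  refine lintegral_congr fun y => lintegral_congr fun x => ?_
  rw [← mul_assoc, ← mul_assoc, ← ENNReal.ofReal_mul (hf0 w x), ← ENNReal.ofReal_mul (hg0 w y),
    hw x y]

theorem HasCondDensity.of_mul_eq [SFinite P] [SFinite μ] [SFinite ν]
    (hW : Measurable W) (hX : Measurable X) (hY : Measurable Y)
    (hf : Measurable (uncurry f)) (hk : Measurable (uncurry k))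
    (hg : Measurable (uncurry g)) (hh : Measurable (uncurry h))
    (hf0 : 0 ≤ f) (hg0 : 0 ≤ g)
    (hXW : HasCondDensity X W P μ f) (hYXW : HasCondDensity Y (fun ω => (X ω, W ω)) P ν k)
    (hfk : ∀ᵐ w ∂(P.map W), ∀ x y, f w x * k (x, w) y = g w y * h (w, y) x)
    (hh1 : ∀ᵐ w ∂(P.map W), ∀ y, ∫⁻ x, ENNReal.ofReal (h (w, y) x) ∂μ = 1) :
    HasCondDensity Y W P ν g ∧ HasCondDensity X (fun ω => (W ω, Y ω)) P μ h := by
  have : Measurable fun p : (S × F) × E => ENNReal.ofReal (h p.1 p.2) := hh.ennreal_ofReal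
  have density_Y : HasCondDensity Y W P ν g := by
    refine (hasCondDensity_iff_lintegral hY hW hg).2 fun F' hF => ?_
    rw [lintegral_eq_of_density_mul_eq hW hX hY hf hk hh hf0 hg0 hXW hYXW hfk
      (F' := fun p => F' p.1) (by fun_prop)]
    refine lintegral_congr_ae ?_
    filter_upwards [hh1] with w hw
    refine lintegral_congr fun y => ?_
    rw [lintegral_mul_const _ (by fun_prop), hw y, one_mul]
  refine ⟨density_Y, (hasCondDensity_iff_lintegral hX (hW.prodMk hY) hh).2 fun F' hF => ?_⟩
  have inner_measurable : Measurable fun p : S × F =>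
      ∫⁻ x, ENNReal.ofReal (h p x) * F' (p, x) ∂μ := by fun_prop
  rw [lintegral_map inner_measurable (hW.prodMk hY),
    (hasCondDensity_iff_lintegral hY hW hg).1 density_Y _ inner_measurable]
  exact lintegral_eq_of_density_mul_eq hW hX hY hf hk hh hf0 hg0 hXW hYXW hfk hF

end Bayes

theorem exists_isFiniteKernel_ae_eq {μ : Measure S} (η : Kernel S E)
    (hη : ∀ᵐ w ∂μ, IsProbabilityMeasure (η w)) :
    ∃ η' : Kernel S E, IsFiniteKernel η' ∧ η' =ᵐ[μ] η := by
  classical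
  have hG : MeasurableSet {w | η w univ ≤ 1} :=
    measurableSet_le (η.measurable_coe MeasurableSet.univ) measurable_const
  refine ⟨Kernel.piecewise hG η 0, ⟨1, ENNReal.one_lt_top, fun w => ?_⟩, ?_⟩
  · rw [Kernel.piecewise_apply]
    split_ifs with hw
    exacts [hw, by simp]
  · filter_upwards [hη] with w hw
    exact (Kernel.piecewise_apply w).trans (if_pos (measure_univ (μ := η w)).le)

theorem condLaw_iff_hasCondDensity [StandardBorelSpace E] [Nonempty E] [IsFiniteMeasure P]
    [SFinite ν] {κ : S → Measure E} (hV : Measurable V) (hk : Measurable (uncurry k))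
    (hκ : ∀ᵐ w ∂(P.map W), κ w = ν.withDensity fun v => ENNReal.ofReal (k w v))
    (hκ1 : ∀ᵐ w ∂(P.map W), IsProbabilityMeasure (κ w)) :
    CondLaw V W P κ ↔ HasCondDensity V W P ν k := by
  have hk' : Measurable (uncurry fun w v => ENNReal.ofReal (k w v)) := hk.ennreal_ofReal
  let η : Kernel S E := (Kernel.const S ν).withDensity fun w v => ENNReal.ofReal (k w v)
  have : IsSFiniteKernel η :=
    Kernel.IsSFiniteKernel.withDensity _ fun w v => ENNReal.ofReal_ne_top
  have η_eq : ∀ᵐ w ∂(P.map W), η w = κ w := by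
    filter_upwards [hκ] with w hw
    rw [hw, Kernel.withDensity_apply _ hk', Kernel.const_apply]
  obtain ⟨η', _, η'_eq⟩ := exists_isFiniteKernel_ae_eq (μ := P.map W) η <| by
    filter_upwards [η_eq, hκ1] with w hw hw1 using hw ▸ hw1
  rw [HasCondDensity, ← Measure.compProd_const, ← Measure.compProd_withDensity hk',
    ← Measure.compProd_congr η'_eq, ← condDistrib_ae_eq_iff_measure_eq_compProd W hV.aemeasurable]
  constructor
  · intro h
    filter_upwards [h, η_eq, η'_eq] with w h1 h2 h3 using by rw [h1, h3, h2]
  · intro h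
    filter_upwards [h, η_eq, η'_eq] with w h1 h2 h3 using by rw [h1, h3, h2]

end ConditionalDensity

/-! ### Positive definite matrices -/

section PosDef

variable {ι : Type*} [Fintype ι] [DecidableEq ι] {S : Matrix ι ι ℝ}

omit [Fintype ι] [DecidableEq ι] in
theorem transpose_eq_of_posDef (hS : S.PosDef) : Sᵀ = S :=
  Matrix.isHermitian_iff_isSymm.1 hS.isHermitian

theorem isUnit_det_of_posDef (hS : S.PosDef) : IsUnit S.det :=
  (Matrix.isUnit_iff_isUnit_det S).1 hS.isUnit

theorem inv_smul_of_isUnit_det (hS : IsUnit S.det) (v : ℝ) :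
    (v • S)⁻¹ = v⁻¹ • S⁻¹ := by
  rcases eq_or_ne v 0 with rfl | hv
  · rw [zero_smul, inv_zero, zero_smul, Matrix.inv_zero]
  · exact Matrix.inv_smul' S (Units.mk0 v hv) hS

theorem sqrt_mul_sqrt_of_posDef (hS : S.PosDef) : CFC.sqrt S * CFC.sqrt S = S :=
  CFC.sqrt_mul_sqrt_self S hS.posSemidef.nonneg

theorem sqrt_posDef (hS : S.PosDef) : (CFC.sqrt S).PosDef := by
  refine (Matrix.nonneg_iff_posSemidef.1 (CFC.sqrt_nonneg S)).posDef_iff_isUnit.2 ?_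
  exact isUnit_of_mul_isUnit_left (sqrt_mul_sqrt_of_posDef hS ▸ hS.isUnit)

theorem sqrt_inv_mul_sqrt_inv (hS : S.PosDef) : (CFC.sqrt S)⁻¹ * (CFC.sqrt S)⁻¹ = S⁻¹ := by
  rw [← Matrix.mul_inv_rev, sqrt_mul_sqrt_of_posDef hS]

theorem dotProduct_inv_mulVec_sqrt_mulVec (hS : S.PosDef) (x : ι → ℝ) :
    (CFC.sqrt S *ᵥ x) ⬝ᵥ (S⁻¹ *ᵥ (CFC.sqrt S *ᵥ x)) = x ⬝ᵥ x := by
  have sqrt_unit := isUnit_det_of_posDef (sqrt_posDef hS)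
  rw [← sqrt_inv_mul_sqrt_inv hS, Matrix.mulVec_mulVec, Matrix.mul_assoc,
    Matrix.nonsing_inv_mul _ sqrt_unit, Matrix.mul_one, Matrix.dotProduct_mulVec,
    Matrix.vecMul_mulVec, transpose_eq_of_posDef (sqrt_posDef hS),
    Matrix.mul_nonsing_inv _ sqrt_unit, Matrix.vecMul_one]

end PosDef

/-! ### Multivariate normal densities -/

section NormalDensity

theorem pi_withDensity_ofReal {ι : Type*} [Fintype ι] {X : ι → Type*}
    [∀ i, MeasurableSpace (X i)] {μ : ∀ i, Measure (X i)} [∀ i, SigmaFinite (μ i)]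
    {f : ∀ i, X i → ℝ} (hf : ∀ i, Integrable (f i) (μ i)) (hf0 : ∀ i, 0 ≤ f i) :
    Measure.pi (fun i => (μ i).withDensity fun x => ENNReal.ofReal (f i x)) =
      (Measure.pi μ).withDensity fun x => ENNReal.ofReal (∏ i, f i (x i)) := by
  refine Measure.pi_eq fun s hs => ?_
  have indicator_nonneg (i : ι) (x : X i) : 0 ≤ (s i).indicator (f i) x :=
    Set.indicator_nonneg (fun y _ => hf0 i y) x
  have indicator_prod (x : ∀ i, X i) :
      (univ.pi s).indicator (fun x => ENNReal.ofReal (∏ i, f i (x i))) x =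
        ENNReal.ofReal (∏ i, (s i).indicator (f i) (x i)) := by
    by_cases hx : x ∈ univ.pi s
    · rw [indicator_of_mem hx]
      congr 1
      exact Finset.prod_congr rfl fun i _ => (indicator_of_mem (hx i (mem_univ i)) _).symm
    · rw [indicator_of_notMem hx]
      obtain ⟨i, hi⟩ : ∃ i, x i ∉ s i := by simpa only [mem_univ_pi, not_forall] using hx
      rw [Finset.prod_eq_zero (Finset.mem_univ i) (indicator_of_notMem hi _), ENNReal.ofReal_zero]
  rw [withDensity_apply _ (.univ_pi hs), ← lintegral_indicator (.univ_pi hs),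
    lintegral_congr indicator_prod, ← ofReal_integral_eq_lintegral_ofReal
      (Integrable.fintype_prod_dep fun i => (hf i).indicator (hs i))
      (.of_forall fun x => Finset.prod_nonneg fun i _ => indicator_nonneg i _),
    integral_fintype_prod_eq_prod,
    ENNReal.ofReal_prod_of_nonneg fun i _ => integral_nonneg (indicator_nonneg i)]
  refine Finset.prod_congr rfl fun i _ => ?_
  rw [integral_indicator (hs i), withDensity_apply _ (hs i),
    ofReal_integral_eq_lintegral_ofReal (hf i).integrableOn (.of_forall (hf0 i))]

theorem lintegral_comp_add_mulVec {ι : Type*} [Fintype ι] [DecidableEq ι] {A : Matrix ι ι ℝ}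
    (hA : A.det ≠ 0) (m : ι → ℝ) {g : (ι → ℝ) → ENNReal} (hg : Measurable g) :
    ENNReal.ofReal |A.det| * ∫⁻ x, g (m + A *ᵥ x) = ∫⁻ x, g x := by
  have map_volume := Real.map_matrix_volume_pi_eq_smul_volume_pi hA
  have pushforward : ∫⁻ x, g (m + A *ᵥ x) =
      ∫⁻ x, g (m + x) ∂(Measure.map (Matrix.toLin' A) volume) :=
    (lintegral_map (f := fun x => g (m + x)) (by fun_prop)
      (Matrix.toLin' A).continuous_of_finiteDimensional.measurable).symm
  rw [pushforward, map_volume, lintegral_smul_measure, lintegral_add_left_eq_self, smul_eq_mul,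
    ← mul_assoc, ← ENNReal.ofReal_mul (abs_nonneg _), ← abs_mul, mul_inv_cancel₀ hA, abs_one,
    ENNReal.ofReal_one, one_mul]

variable {p : ℕ} {S : Matrix (Fin p) (Fin p) ℝ}

theorem normalPDF_nonneg (m : Fin p → ℝ) (S : Matrix (Fin p) (Fin p) ℝ) (y : Fin p → ℝ) :
    0 ≤ normalPDF m S y := by
  unfold normalPDF; positivity

theorem measurable_normalPDF_smul {α : Type*} [MeasurableSpace α] (hS : S.PosDef)
    {m y : α → Fin p → ℝ} {v : α → ℝ} (hm : Measurable m) (hv : Measurable v) (hy : Measurable y) :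
    Measurable fun a => normalPDF (m a) (v a • S) (y a) := by
  have : Measurable fun x : Fin p → ℝ => x ⬝ᵥ (S⁻¹ *ᵥ x) :=
    (by fun_prop : Continuous fun x : Fin p → ℝ => x ⬝ᵥ (S⁻¹ *ᵥ x)).measurable
  simp only [normalPDF, Matrix.det_smul, inv_smul_of_isUnit_det (isUnit_det_of_posDef hS),
    Matrix.smul_mulVec, dotProduct_smul, smul_eq_mul]
  fun_prop

theorem abs_det_sqrt_mul_normalPDF (hS : S.PosDef) (m x : Fin p → ℝ) :
    |(CFC.sqrt S).det| * normalPDF m S (m + CFC.sqrt S *ᵥ x) = ∏ i, gaussianPDFReal 0 1 (x i) := by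
  have det_sqrt : (CFC.sqrt S).det = √S.det := by
    rw [hS.posSemidef.det_sqrt, RCLike.sqrt_of_nonneg hS.det_pos.le]; rfl
  have sqrt_det_pos : 0 < √S.det := Real.sqrt_pos.2 hS.det_pos
  have sqrt_pow : √((2 * Real.pi) ^ p) = √(2 * Real.pi) ^ p := by
    rw [Real.sqrt_eq_iff_mul_self_eq (by positivity) (by positivity), ← mul_pow,
      Real.mul_self_sqrt (by positivity)]
  rw [normalPDF, add_sub_cancel_left, dotProduct_inv_mulVec_sqrt_mulVec hS, det_sqrt,
    abs_of_pos sqrt_det_pos, Real.sqrt_mul (by positivity), sqrt_pow]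
  simp only [gaussianPDFReal, NNReal.coe_one, mul_one, sub_zero, Finset.prod_mul_distrib,
    Finset.prod_const, Finset.card_univ, Fintype.card_fin, ← Real.exp_sum, ← Finset.sum_div,
    Finset.sum_neg_distrib, dotProduct, ← sq, inv_pow]
  field_simp

theorem multivariateGaussian_eq_map_pi (m : Fin p → ℝ) :
    multivariateGaussian (WithLp.toLp 2 m) S =
      (Measure.pi fun _ : Fin p => gaussianReal 0 1).map
        fun x => WithLp.toLp 2 (m + CFC.sqrt S *ᵥ x) := by
  rw [multivariateGaussian, ← map_pi_eq_stdGaussian, Measure.map_map (by fun_prop) (by fun_prop)]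
  rfl

theorem multivariateGaussian_eq_withDensity (hS : S.PosDef) (m : Fin p → ℝ) :
    multivariateGaussian (WithLp.toLp 2 m) S =
      volume.withDensity fun y => ENNReal.ofReal (normalPDF m S y.ofLp) := by
  have pi_gaussian : Measure.pi (fun _ : Fin p => gaussianReal 0 1) =
      volume.withDensity fun x => ENNReal.ofReal (∏ i, gaussianPDFReal 0 1 (x i)) := by
    rw [volume_pi, ← pi_withDensity_ofReal (fun _ => integrable_gaussianPDFReal 0 1)
      fun _ => gaussianPDFReal_nonneg 0 1, gaussianReal_of_var_ne_zero 0 one_ne_zero]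
    rfl
  set φ : (Fin p → ℝ) → EuclideanSpace ℝ (Fin p) := fun x => WithLp.toLp 2 (m + CFC.sqrt S *ᵥ x)
  have map_measurable : Measurable φ :=
    (MeasurableEquiv.toLp 2 _).measurable.comp
      (by fun_prop : Continuous fun x : Fin p → ℝ => m + CFC.sqrt S *ᵥ x).measurable
  have density_measurable : Measurable (normalPDF m S) := by
    simpa only [one_smul, id_eq] using
      measurable_normalPDF_smul hS measurable_const (measurable_const (a := (1 : ℝ))) measurable_id
  refine Measure.ext_of_lintegral _ fun g hg => ?_
  rw [multivariateGaussian_eq_map_pi, lintegral_map hg map_measurable, pi_gaussian,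
    lintegral_withDensity_eq_lintegral_mul (g := fun x => g (φ x)) _ (by fun_prop)
      (hg.comp map_measurable),
    lintegral_withDensity_eq_lintegral_mul _ (by fun_prop) hg,
    ← (PiLp.volume_preserving_toLp (Fin p)).lintegral_comp (by fun_prop)]
  simp only [Pi.mul_apply]
  rw [← lintegral_comp_add_mulVec (g := fun x => ENNReal.ofReal (normalPDF m S x) *
      g (WithLp.toLp 2 x)) (sqrt_posDef hS).det_pos.ne' m (by fun_prop),
    ← lintegral_const_mul' _ _ ENNReal.ofReal_ne_top]
  refine lintegral_congr fun x => ?_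
  rw [← abs_det_sqrt_mul_normalPDF hS m, ENNReal.ofReal_mul (abs_nonneg _), mul_assoc]

end NormalDensity

section CompletionOfSquare

variable {ι κ : Type*} [Fintype ι] [DecidableEq ι] [Fintype κ] [DecidableEq κ]
  {S : Matrix κ κ ℝ} {R : Matrix ι ι ℝ}

omit [DecidableEq ι] in
theorem dotProduct_mulVec_comm_of_posDef (hR : R.PosDef) (x y : ι → ℝ) :
    x ⬝ᵥ (R *ᵥ y) = y ⬝ᵥ (R *ᵥ x) := by
  rw [Matrix.dotProduct_mulVec, dotProduct_comm, ← Matrix.mulVec_transpose,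
    transpose_eq_of_posDef hR]

omit [DecidableEq ι] in
theorem sub_dotProduct_mulVec_sub (hR : R.PosDef) (x y : ι → ℝ) :
    (x - y) ⬝ᵥ (R *ᵥ (x - y)) = x ⬝ᵥ (R *ᵥ x) - 2 * (x ⬝ᵥ (R *ᵥ y)) + y ⬝ᵥ (R *ᵥ y) := by
  simp only [Matrix.mulVec_sub, dotProduct_sub, sub_dotProduct,
    dotProduct_mulVec_comm_of_posDef hR y x]
  ring

/-- The covariance matrix of `b` given `y` in the Bayesian linear model `b ∼ N(m, S)`,
`y | b ∼ N(a + Z b, R)`. -/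
noncomputable def posteriorCov (S : Matrix κ κ ℝ) (R : Matrix ι ι ℝ) (Z : Matrix ι κ ℝ) :
    Matrix κ κ ℝ :=
  (S⁻¹ + Zᵀ * R⁻¹ * Z)⁻¹

theorem posterior_precision_posDef (hS : S.PosDef) (hR : R.PosDef) (Z : Matrix ι κ ℝ) :
    (S⁻¹ + Zᵀ * R⁻¹ * Z).PosDef := by
  rw [← Matrix.conjTranspose_eq_transpose_of_trivial]
  exact hS.inv.add_posSemidef (hR.inv.posSemidef.conjTranspose_mul_mul_same Z)

theorem posteriorCov_posDef (hS : S.PosDef) (hR : R.PosDef) (Z : Matrix ι κ ℝ) :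
    (posteriorCov S R Z).PosDef :=
  (posterior_precision_posDef hS hR Z).inv

omit [Fintype ι] [DecidableEq ι] [DecidableEq κ] in
theorem add_mul_mul_transpose_posDef [Finite ι] (hS : S.PosDef) (hR : R.PosDef)
    (Z : Matrix ι κ ℝ) : (R + Z * S * Zᵀ).PosDef := by
  rw [← Matrix.conjTranspose_eq_transpose_of_trivial]
  exact hR.add_posSemidef (hS.posSemidef.mul_mul_conjTranspose_same Z)

theorem posteriorCov_smul (hS : S.PosDef) (hR : R.PosDef) (Z : Matrix ι κ ℝ) (v : ℝ) :
    posteriorCov (v • S) (v • R) Z = v • posteriorCov S R Z := by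
  rw [posteriorCov, inv_smul_of_isUnit_det (isUnit_det_of_posDef hS),
    inv_smul_of_isUnit_det (isUnit_det_of_posDef hR), Matrix.mul_smul, Matrix.smul_mul, ← smul_add,
    inv_smul_of_isUnit_det (isUnit_det_of_posDef (posterior_precision_posDef hS hR Z)), inv_inv]
  rfl

theorem add_mul_mul_transpose_inv (hS : S.PosDef) (hR : R.PosDef) (Z : Matrix ι κ ℝ) :
    (R + Z * S * Zᵀ)⁻¹ = R⁻¹ - R⁻¹ * Z * posteriorCov S R Z * Zᵀ * R⁻¹ :=
  Matrix.add_mul_mul_inv_eq_sub _ _ _ _ hR.isUnit hS.isUnit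
    (posterior_precision_posDef hS hR Z).isUnit

theorem posteriorCov_eq_sub (hS : S.PosDef) (hR : R.PosDef) (Z : Matrix ι κ ℝ) :
    posteriorCov S R Z = S - S * Zᵀ * (R + Z * S * Zᵀ)⁻¹ * Z * S := by
  have hS_inv := Matrix.nonsing_inv_nonsing_inv _ (isUnit_det_of_posDef hS)
  have hR_inv := Matrix.nonsing_inv_nonsing_inv _ (isUnit_det_of_posDef hR)
  rw [posteriorCov, Matrix.add_mul_mul_inv_eq_sub _ _ _ _ hS.inv.isUnit hR.inv.isUnit, hS_inv,
    hR_inv]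
  rw [hS_inv, hR_inv]
  exact (add_mul_mul_transpose_posDef hS hR Z).isUnit

theorem det_add_mul_mul_transpose_mul_det_posteriorCov (hS : S.PosDef) (hR : R.PosDef)
    (Z : Matrix ι κ ℝ) :
    (R + Z * S * Zᵀ).det * (posteriorCov S R Z).det = R.det * S.det := by
  have precision_unit := isUnit_det_of_posDef (posterior_precision_posDef hS hR Z)
  have factor : 1 + S * Zᵀ * R⁻¹ * Z = S * (S⁻¹ + Zᵀ * R⁻¹ * Z) := by
    rw [Matrix.mul_add, Matrix.mul_nonsing_inv _ (isUnit_det_of_posDef hS)]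
    simp only [Matrix.mul_assoc]
  rw [Matrix.mul_assoc Z, Matrix.det_add_mul _ _ (isUnit_det_of_posDef hR), factor,
    Matrix.det_mul, posteriorCov, Matrix.det_nonsing_inv, mul_assoc, mul_assoc,
    Ring.mul_inverse_cancel _ precision_unit, mul_one]

theorem completion_of_square (hS : S.PosDef) (hR : R.PosDef) (Z : Matrix ι κ ℝ) (x : κ → ℝ)
    (e : ι → ℝ) :
    x ⬝ᵥ (S⁻¹ *ᵥ x) + (e - Z *ᵥ x) ⬝ᵥ (R⁻¹ *ᵥ (e - Z *ᵥ x)) =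
      e ⬝ᵥ ((R + Z * S * Zᵀ)⁻¹ *ᵥ e) +
        (x - (posteriorCov S R Z * Zᵀ * R⁻¹) *ᵥ e) ⬝ᵥ
          ((posteriorCov S R Z)⁻¹ *ᵥ (x - (posteriorCov S R Z * Zᵀ * R⁻¹) *ᵥ e)) := by
  have precision := posterior_precision_posDef hS hR Z
  have cov_inv : (posteriorCov S R Z)⁻¹ = S⁻¹ + Zᵀ * R⁻¹ * Z :=
    Matrix.nonsing_inv_nonsing_inv _ (isUnit_det_of_posDef precision)
  have precision_gain : (S⁻¹ + Zᵀ * R⁻¹ * Z) *ᵥ ((posteriorCov S R Z * Zᵀ * R⁻¹) *ᵥ e) =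
      (Zᵀ * R⁻¹) *ᵥ e := by
    rw [posteriorCov, Matrix.mulVec_mulVec, ← Matrix.mul_assoc, ← Matrix.mul_assoc,
      Matrix.mul_nonsing_inv _ (isUnit_det_of_posDef precision), Matrix.one_mul]
  have adjoint (x : κ → ℝ) (e : ι → ℝ) : x ⬝ᵥ ((Zᵀ * R⁻¹) *ᵥ e) = e ⬝ᵥ (R⁻¹ *ᵥ (Z *ᵥ x)) := by
    rw [← Matrix.mulVec_mulVec, Matrix.dotProduct_mulVec, Matrix.vecMul_transpose,
      dotProduct_mulVec_comm_of_posDef hR.inv]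
  rw [cov_inv, sub_dotProduct_mulVec_sub hR.inv, sub_dotProduct_mulVec_sub precision,
    precision_gain, adjoint, adjoint, add_mul_mul_transpose_inv hS hR, Matrix.add_mulVec,
    dotProduct_add, Matrix.mul_assoc Zᵀ, ← Matrix.mulVec_mulVec x Zᵀ, Matrix.dotProduct_mulVec x Zᵀ,
    Matrix.vecMul_transpose, ← Matrix.mulVec_mulVec x, Matrix.sub_mulVec, dotProduct_sub]
  simp only [Matrix.mulVec_mulVec, Matrix.mul_assoc]
  ring

end CompletionOfSquare

section GaussianBayes

variable {n q : ℕ} {S : Matrix (Fin q) (Fin q) ℝ} {R : Matrix (Fin n) (Fin n) ℝ}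

theorem normalPDF_mul_normalPDF (hS : S.PosDef) (hR : R.PosDef) (Z : Matrix (Fin n) (Fin q) ℝ)
    (m b : Fin q → ℝ) (a y : Fin n → ℝ) :
    normalPDF m S b * normalPDF (a + Z *ᵥ b) R y =
      normalPDF (a + Z *ᵥ m) (R + Z * S * Zᵀ) y *
        normalPDF (m + (posteriorCov S R Z * Zᵀ * R⁻¹) *ᵥ (y - (a + Z *ᵥ m)))
          (posteriorCov S R Z) b := by
  have residual : y - (a + Z *ᵥ b) = y - (a + Z *ᵥ m) - Z *ᵥ (b - m) := by
    rw [Matrix.mulVec_sub]; abel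
  have square := completion_of_square hS hR Z (b - m) (y - (a + Z *ᵥ m))
  have dets := det_add_mul_mul_transpose_mul_det_posteriorCov hS hR Z
  have det_S := hS.det_pos.le
  have det_marginal := (add_mul_mul_transpose_posDef hS hR Z).det_pos.le
  have normalization :
      √((2 * Real.pi) ^ q * S.det) * √((2 * Real.pi) ^ n * R.det) =
        √((2 * Real.pi) ^ n * (R + Z * S * Zᵀ).det) *
          √((2 * Real.pi) ^ q * (posteriorCov S R Z).det) := by
    rw [← Real.sqrt_mul (by positivity), ← Real.sqrt_mul (by positivity)]
    congr 1
    linear_combination -(2 * Real.pi) ^ q * (2 * Real.pi) ^ n * dets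
  rw [← residual] at square
  simp only [normalPDF, ← sub_sub b m]
  rw [mul_mul_mul_comm, ← mul_inv, normalization, mul_inv, ← Real.exp_add, ← add_div, ← neg_add,
    square, neg_add, add_div, Real.exp_add, mul_mul_mul_comm]

theorem normalPDF_fin_one {v : ℝ} (hv : 0 < v) (m t : ℝ) :
    normalPDF (fun _ : Fin 1 => m) (v • 1) (fun _ => t) = gaussianPDFReal m v.toNNReal t := by
  have exponent : -((t - m) * (v⁻¹ * (t - m))) / 2 = -(t - m) ^ 2 / (2 * v) := by field_simp
  simp [normalPDF, gaussianPDFReal, Real.coe_toNNReal _ hv.le, dotProduct, ← exponent]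

theorem posteriorCov_replicateCol {v : ℝ} (h : Fin n → ℝ) :
    posteriorCov (v • (1 : Matrix (Fin 1) (Fin 1) ℝ)) R (Matrix.replicateCol (Fin 1) h) =
      (v⁻¹ + h ⬝ᵥ (R⁻¹ *ᵥ h))⁻¹ • 1 := by
  rw [posteriorCov, inv_smul_of_isUnit_det (by simp), inv_one]
  have precision : v⁻¹ • (1 : Matrix (Fin 1) (Fin 1) ℝ) +
      (Matrix.replicateCol (Fin 1) h)ᵀ * R⁻¹ * Matrix.replicateCol (Fin 1) h =
      (v⁻¹ + h ⬝ᵥ (R⁻¹ *ᵥ h)) • 1 := by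
    ext i j
    fin_cases i; fin_cases j
    simp [Matrix.mul_assoc, Matrix.mul_apply, dotProduct, Matrix.mulVec]
  rw [precision, inv_smul_of_isUnit_det (by simp), inv_one]

theorem gaussianPDFReal_mul_normalPDF (hR : R.PosDef) {v : ℝ} (hv : 0 < v) (h a y : Fin n → ℝ)
    (m t : ℝ) :
    gaussianPDFReal m v.toNNReal t * normalPDF (a + t • h) R y =
      normalPDF (a + m • h) (R + v • Matrix.vecMulVec h h) y *
        gaussianPDFReal
          (m + (v⁻¹ + h ⬝ᵥ (R⁻¹ *ᵥ h))⁻¹ * (h ⬝ᵥ (R⁻¹ *ᵥ (y - (a + m • h)))))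
          (v⁻¹ + h ⬝ᵥ (R⁻¹ *ᵥ h))⁻¹.toNNReal t := by
  have hS : (v • (1 : Matrix (Fin 1) (Fin 1) ℝ)).PosDef := Matrix.PosDef.one.smul hv
  have quadratic_nonneg : 0 ≤ h ⬝ᵥ (R⁻¹ *ᵥ h) := by
    simpa using hR.inv.posSemidef.dotProduct_mulVec_nonneg h
  have column (x : ℝ) : Matrix.replicateCol (Fin 1) h *ᵥ (fun _ => x) = x • h := by
    ext i; simp [Matrix.mulVec, dotProduct, mul_comm]
  have outer : Matrix.replicateCol (Fin 1) h * (v • (1 : Matrix (Fin 1) (Fin 1) ℝ)) *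
      (Matrix.replicateCol (Fin 1) h)ᵀ = v • Matrix.vecMulVec h h := by
    ext i j; simp [Matrix.mul_apply, Matrix.vecMulVec, mul_assoc]
  have gain (e : Fin n → ℝ) :
      (((v⁻¹ + h ⬝ᵥ (R⁻¹ *ᵥ h))⁻¹ • (1 : Matrix (Fin 1) (Fin 1) ℝ)) *
        (Matrix.replicateCol (Fin 1) h)ᵀ * R⁻¹) *ᵥ e =
          fun _ => (v⁻¹ + h ⬝ᵥ (R⁻¹ *ᵥ h))⁻¹ * (h ⬝ᵥ (R⁻¹ *ᵥ e)) := by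
    rw [Matrix.smul_mul, Matrix.one_mul, Matrix.smul_mul, Matrix.smul_mulVec,
      ← Matrix.mulVec_mulVec]
    rfl
  have bayes := normalPDF_mul_normalPDF hS hR (Matrix.replicateCol (Fin 1) h) (fun _ => m)
    (fun _ => t) a y
  rw [posteriorCov_replicateCol, outer, gain, column, column, normalPDF_fin_one hv] at bayes
  rw [bayes, ← normalPDF_fin_one (by positivity)]
  rfl

end GaussianBayes

/-! ### The truncated normal distribution -/

section TruncatedNormal

theorem gaussianReal_Ioi (m c : ℝ) {v : ℝ} (hv : 0 < v) :
    gaussianReal m v.toNNReal (Ioi c) = ENNReal.ofReal (stdNormalCDF ((m - c) / √v)) := by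
  have reflected : gaussianReal m v.toNNReal = (gaussianReal 0 1).map (fun x => m - √v * x) := by
    rw [show (fun x => m - √v * x) = (fun x => m - x) ∘ (fun x => √v * x) from rfl,
      ← Measure.map_map (by fun_prop) (by fun_prop), gaussianReal_map_const_mul,
      gaussianReal_map_const_sub]
    congr 1
    · simp
    · ext; simp [Real.sq_sqrt hv.le, hv.le]
  have preimage : (fun x => m - √v * x) ⁻¹' Ioi c = Iio ((m - c) / √v) := by
    ext x
    rw [mem_preimage, mem_Ioi, mem_Iio, lt_div_iff₀ (Real.sqrt_pos.2 hv), lt_sub_comm, mul_comm]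
  have : NullSingletonClass (gaussianReal 0 1) := nullSingletonClass_gaussianReal one_ne_zero
  rw [reflected, Measure.map_apply (by fun_prop) measurableSet_Ioi, preimage, stdNormalCDF,
    ofReal_cdf, measure_congr Iio_ae_eq_Iic]

theorem stdNormalCDF_pos (x : ℝ) : 0 < stdNormalCDF x := by
  have hx : gaussianReal 0 1 (Iic x) ≠ 0 := fun h => by
    simpa using gaussianReal_absolutelyContinuous' 0 one_ne_zero h
  rwa [← ofReal_cdf, ne_eq, ENNReal.ofReal_eq_zero, not_le] at hx

theorem stdNormalCDF_zero : stdNormalCDF 0 = 1 / 2 := by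
  have upper := gaussianReal_Ioi 0 0 one_pos
  have lower : gaussianReal 0 1 (Iic 0) = ENNReal.ofReal (stdNormalCDF 0) := (ofReal_cdf _ _).symm
  have total := prob_add_prob_compl (μ := gaussianReal 0 1) (measurableSet_Iic (a := (0 : ℝ)))
  rw [sub_zero, zero_div, Real.toNNReal_one] at upper
  rw [compl_Iic, upper, lower, ← ENNReal.ofReal_add (stdNormalCDF_pos 0).le
    (stdNormalCDF_pos 0).le, ENNReal.ofReal_eq_one] at total
  linarith

@[fun_prop]
theorem measurable_stdNormalCDF : Measurable stdNormalCDF :=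
  (monotone_cdf (gaussianReal 0 1)).measurable

/-- The Lebesgue density of `TN(m, v; (c, ∞))`. -/
noncomputable def truncNormalPDF (m v c t : ℝ) : ℝ :=
  (Ioi c).indicator (fun t => gaussianPDFReal m v.toNNReal t / stdNormalCDF ((m - c) / √v)) t

theorem truncNormalPDF_nonneg (m v c t : ℝ) : 0 ≤ truncNormalPDF m v c t :=
  indicator_nonneg (fun _ _ => div_nonneg (gaussianPDFReal_nonneg _ _ _) (stdNormalCDF_pos _).le) _

theorem measurable_truncNormalPDF {α : Type*} [MeasurableSpace α] {m v t : α → ℝ}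
    (hm : Measurable m) (hv : Measurable v) (ht : Measurable t) (c : ℝ) :
    Measurable fun a => truncNormalPDF (m a) (v a) c (t a) := by
  have hpdf : Measurable fun a => gaussianPDFReal (m a) (v a).toNNReal (t a) :=
    measurable_uncurry_gaussianPDFReal.comp (hm.prodMk (hv.real_toNNReal.prodMk ht))
  exact (hpdf.div (by fun_prop)).indicator (ht measurableSet_Ioi)

theorem truncNormal_Ioi_eq_withDensity (m c : ℝ) {v : ℝ} (hv : 0 < v) :
    truncNormal m v (Ioi c) =
      volume.withDensity fun t => ENNReal.ofReal (truncNormalPDF m v c t) := by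
  have hv' : v.toNNReal ≠ 0 := by simpa using hv
  rw [truncNormal, ProbabilityTheory.cond, gaussianReal_Ioi m c hv,
    gaussianReal_of_var_ne_zero m hv', restrict_withDensity measurableSet_Ioi,
    ← withDensity_indicator measurableSet_Ioi,
    ← withDensity_smul _ ((measurable_gaussianPDF _ _).indicator measurableSet_Ioi)]
  congr 1 with t
  by_cases ht : t ∈ Ioi c
  · simp [truncNormalPDF, ht, gaussianPDF, ENNReal.ofReal_div_of_pos (stdNormalCDF_pos _),
      ENNReal.div_eq_inv_mul]
  · simp [truncNormalPDF, ht]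

theorem isProbabilityMeasure_truncNormal_Ioi (m c : ℝ) {v : ℝ} (hv : 0 < v) :
    IsProbabilityMeasure (truncNormal m v (Ioi c)) := by
  refine cond_isProbabilityMeasure ?_
  rw [gaussianReal_Ioi m c hv]
  simpa using stdNormalCDF_pos _

theorem integrable_gaussianReal_iff {m : ℝ} {v : NNReal} (hv : v ≠ 0) {f : ℝ → ℝ} :
    Integrable f (gaussianReal m v) ↔ Integrable fun t => gaussianPDFReal m v t * f t := by
  rw [gaussianReal_of_var_ne_zero _ hv, integrable_withDensity_iff_integrable_smul'
    (measurable_gaussianPDF _ _) (Filter.Eventually.of_forall fun _ => gaussianPDF_lt_top)]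
  simp only [toReal_gaussianPDF, smul_eq_mul]

theorem setIntegral_Ioi_gaussianReal (m c : ℝ) {v : NNReal} (hv : v ≠ 0) (f : ℝ → ℝ) :
    ∫ t in Ioi c, f t ∂gaussianReal m v = ∫ t in Ioi c, gaussianPDFReal m v t * f t := by
  rw [gaussianReal_of_var_ne_zero _ hv, setIntegral_withDensity_eq_setIntegral_toReal_smul
    (measurable_gaussianPDF _ _) (Filter.Eventually.of_forall fun _ => gaussianPDF_lt_top) _
    measurableSet_Ioi]
  simp only [toReal_gaussianPDF, smul_eq_mul]

theorem integrable_pow_gaussianReal (m : ℝ) (v : NNReal) (k : ℕ) :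
    Integrable (fun t : ℝ => t ^ k) (gaussianReal m v) :=
  (integrable_norm_iff (by fun_prop)).1 (by
    simpa [norm_pow] using (memLp_id_gaussianReal (μ := m) (v := v) k).integrable_norm_pow')

theorem integrable_pow_truncNormal_Ioi (m c : ℝ) {v : ℝ} (hv : 0 < v) (k : ℕ) :
    Integrable (fun t : ℝ => t ^ k) (truncNormal m v (Ioi c)) := by
  refine (integrable_pow_gaussianReal m v.toNNReal k).restrict.smul_measure ?_
  rw [gaussianReal_Ioi m c hv, ENNReal.inv_ne_top]
  simpa using stdNormalCDF_pos _

theorem hasDerivAt_gaussianPDFReal (m : ℝ) {v : ℝ} (hv : 0 < v) (x : ℝ) :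
    HasDerivAt (gaussianPDFReal m v.toNNReal)
      (-((x - m) / v) * gaussianPDFReal m v.toNNReal x) x := by
  simp only [gaussianPDFReal_def, Real.coe_toNNReal _ hv.le]
  have exponent : HasDerivAt (fun x : ℝ => -(x - m) ^ 2 / (2 * v)) (-((x - m) / v)) x := by
    convert! ((((hasDerivAt_id x).sub_const m).pow 2).neg).div_const (2 * v) using 1
    simp only [id_eq, Nat.cast_ofNat, Nat.add_one_sub_one, pow_one, mul_one]
    field_simp
  convert! exponent.exp.const_mul (√(2 * Real.pi * v))⁻¹ using 1
  ring

theorem sqrt_mul_gaussianPDFReal (m c : ℝ) {v : ℝ} (hv : 0 < v) :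
    √v * gaussianPDFReal m v.toNNReal c = gaussianPDFReal 0 1 ((m - c) / √v) := by
  have exponent : -(c - m) ^ 2 / (2 * v) = -((m - c) ^ 2 / v) / 2 := by field_simp; ring
  simp only [gaussianPDFReal, Real.coe_toNNReal _ hv.le, NNReal.coe_one, mul_one, sub_zero, div_pow,
    Real.sq_sqrt hv.le, exponent]
  rw [Real.sqrt_mul (by positivity)]
  field_simp

theorem setIntegral_Ioi_stein {m v : ℝ} (hv : 0 < v) (c : ℝ) {g g' : ℝ → ℝ}
    (hg : ∀ t, HasDerivAt g (g' t) t) (hgi : Integrable g (gaussianReal m v.toNNReal))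
    (hsi : Integrable (fun t => (t - m) * g t - v * g' t) (gaussianReal m v.toNNReal)) :
    ∫ t in Ioi c, ((t - m) * g t - v * g' t) ∂gaussianReal m v.toNNReal =
      v * (gaussianPDFReal m v.toNNReal c * g c) := by
  have hv' : v.toNNReal ≠ 0 := by simpa using hv
  rw [integrable_gaussianReal_iff hv'] at hgi hsi
  have hderiv (t : ℝ) : HasDerivAt (fun t => -v * (gaussianPDFReal m v.toNNReal t * g t))
      (gaussianPDFReal m v.toNNReal t * ((t - m) * g t - v * g' t)) t := by
    convert! ((hasDerivAt_gaussianPDFReal m hv t).mul (hg t)).const_mul (-v) using 1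
    field_simp
    ring
  have htendsto := tendsto_zero_of_hasDerivAt_of_integrableOn_Ioi (a := c) (fun t _ => hderiv t)
    hsi.integrableOn (hgi.const_mul (-v)).integrableOn
  rw [setIntegral_Ioi_gaussianReal m c hv',
    integral_Ioi_of_hasDerivAt_of_tendsto' (fun t _ => hderiv t) hsi.integrableOn htendsto]
  ring

theorem integral_truncNormal_Ioi_stein {m v : ℝ} (hv : 0 < v) (c : ℝ) {g g' : ℝ → ℝ}
    (hg : ∀ t, HasDerivAt g (g' t) t) (hgi : Integrable g (gaussianReal m v.toNNReal))
    (hsi : Integrable (fun t => (t - m) * g t - v * g' t) (gaussianReal m v.toNNReal)) :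
    ∫ t, ((t - m) * g t - v * g' t) ∂truncNormal m v (Ioi c) =
      √v * g c * WPhi ((m - c) / √v) := by
  rw [truncNormal, ProbabilityTheory.cond, integral_smul_measure,
    setIntegral_Ioi_stein hv c hg hgi hsi, gaussianReal_Ioi m c hv, ENNReal.toReal_inv,
    ENNReal.toReal_ofReal (stdNormalCDF_pos _).le, smul_eq_mul, WPhi,
    ← sqrt_mul_gaussianPDFReal m c hv]
  nth_rewrite 2 [← Real.mul_self_sqrt hv.le]
  ring

theorem integral_id_truncNormal_Ioi (m c : ℝ) {v : ℝ} (hv : 0 < v) :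
    ∫ t, t ∂truncNormal m v (Ioi c) = m + √v * WPhi ((m - c) / √v) := by
  have := isProbabilityMeasure_truncNormal_Ioi m c hv
  have hi := integrable_pow_truncNormal_Ioi m c hv 1
  have hgi := integrable_pow_gaussianReal m v.toNNReal 1
  simp only [pow_one] at hi hgi
  have stein := integral_truncNormal_Ioi_stein hv c (fun t => hasDerivAt_const t (1 : ℝ))
    (integrable_const _) (by simpa using hgi.sub' (integrable_const m))
  simp only [mul_one, mul_zero, sub_zero] at stein
  rw [integral_sub hi (integrable_const m), integral_const, probReal_univ, one_smul] at stein
  linarith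

theorem integral_sq_truncNormal_Ioi (m c : ℝ) {v : ℝ} (hv : 0 < v) :
    ∫ t, t ^ 2 ∂truncNormal m v (Ioi c) =
      v + m ^ 2 + √v * (m + c) * WPhi ((m - c) / √v) := by
  have := isProbabilityMeasure_truncNormal_Ioi m c hv
  have hi1 := integrable_pow_truncNormal_Ioi m c hv 1
  have hi2 := integrable_pow_truncNormal_Ioi m c hv 2
  have hgi := integrable_pow_gaussianReal m v.toNNReal 1
  have hgi2 := integrable_pow_gaussianReal m v.toNNReal 2
  simp only [pow_one] at hi1 hgi
  have hexpand (t : ℝ) : (t - m) * t - v * 1 = t ^ 2 - m * t - v := by ring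
  have stein := integral_truncNormal_Ioi_stein hv c (fun t => hasDerivAt_id' t) hgi (by
    simpa only [hexpand] using (hgi2.sub' (hgi.const_mul m)).sub' (integrable_const v))
  simp only [hexpand] at stein
  rw [integral_sub (hi2.sub' (hi1.const_mul m)) (integrable_const v),
    integral_sub hi2 (hi1.const_mul m), integral_const_mul, integral_const, probReal_univ, one_smul,
    integral_id_truncNormal_Ioi m c hv] at stein
  linarith

theorem integral_sub_sq_truncNormal_Ioi (c : ℝ) {v : ℝ} (hv : 0 < v) :
    ∫ t, (t - c) ^ 2 ∂truncNormal c v (Ioi c) = v := by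
  have := isProbabilityMeasure_truncNormal_Ioi c c hv
  have hi1 := integrable_pow_truncNormal_Ioi c c hv 1
  have hi2 := integrable_pow_truncNormal_Ioi c c hv 2
  simp only [pow_one] at hi1
  simp only [sub_sq, mul_right_comm 2 _ c]
  rw [integral_add (hi2.sub' (hi1.const_mul _)) (integrable_const _),
    integral_sub hi2 (hi1.const_mul _), integral_const_mul, integral_const, probReal_univ, one_smul,
    integral_sq_truncNormal_Ioi c c hv, integral_id_truncNormal_Ioi c c hv]
  ring

theorem div_sqrt_inv_mul_sq (a u : ℝ) {τ : ℝ} (hτ : 0 < τ) :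
    a / √(u⁻¹ * τ ^ 2) = √u * (a / τ) := by
  rw [Real.sqrt_mul' _ (sq_nonneg τ), Real.sqrt_sq hτ.le, Real.sqrt_inv, div_mul_eq_div_div,
    div_inv_eq_mul]
  ring

theorem mul_sqrt_inv_mul_sq (u : ℝ) {τ : ℝ} (hτ : 0 < τ) :
    u * √(u⁻¹ * τ ^ 2) = τ * √u := by
  rw [Real.sqrt_mul' _ (sq_nonneg τ), Real.sqrt_sq hτ.le, Real.sqrt_inv, ← mul_assoc,
    ← div_eq_mul_inv, Real.div_sqrt, mul_comm]

theorem mul_integral_id_truncNormal_Ioi (μ c : ℝ) {u τ : ℝ} (hu : 0 < u) (hτ : 0 < τ) :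
    u * ∫ t, t ∂truncNormal (c + μ) (u⁻¹ * τ ^ 2) (Ioi c) =
      (μ + c) * u + τ * (√u * WPhi (√u * (μ / τ))) := by
  rw [integral_id_truncNormal_Ioi _ _ (by positivity), add_sub_cancel_left,
    div_sqrt_inv_mul_sq _ _ hτ, mul_add, ← mul_assoc, mul_sqrt_inv_mul_sq _ hτ]
  ring

theorem mul_integral_sq_truncNormal_Ioi (μ c : ℝ) {u τ : ℝ} (hu : 0 < u) (hτ : 0 < τ) :
    u * ∫ t, t ^ 2 ∂truncNormal (c + μ) (u⁻¹ * τ ^ 2) (Ioi c) =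
      τ ^ 2 + (μ + c) ^ 2 * u + τ * (μ + 2 * c) * (√u * WPhi (√u * (μ / τ))) := by
  rw [integral_sq_truncNormal_Ioi _ _ (by positivity), add_sub_cancel_left,
    div_sqrt_inv_mul_sq _ _ hτ, mul_add, mul_add, mul_inv_cancel_left₀ hu.ne', mul_assoc √_,
    ← mul_assoc u √_, mul_sqrt_inv_mul_sq _ hτ]
  ring

end TruncatedNormal

/-! ### Matrix identities of the model -/

section RankOne

variable {ι : Type*} [Fintype ι] [DecidableEq ι]

theorem one_sub_vecMulVec_posDef {d : ι → ℝ} (hd : d ⬝ᵥ d < 1) :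
    (1 - Matrix.vecMulVec d d).PosDef := by
  refine Matrix.PosDef.of_dotProduct_mulVec_pos ?_ fun x hx => ?_
  · simp [Matrix.IsHermitian, Matrix.transpose_vecMulVec]
  · have hx_pos : 0 < x ⬝ᵥ x := Matrix.dotProduct_self_star_pos_iff.2 hx
    have cauchy_schwarz : (d ⬝ᵥ x) ^ 2 ≤ (d ⬝ᵥ d) * (x ⬝ᵥ x) := by
      simp only [dotProduct, ← sq]
      exact Finset.sum_mul_sq_le_sq_mul_sq _ _ _
    rw [star_trivial, Matrix.sub_mulVec, dotProduct_sub, Matrix.one_mulVec,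
      Matrix.vecMulVec_mulVec, op_smul_eq_smul, dotProduct_smul, dotProduct_comm x d, smul_eq_mul]
    nlinarith

omit [Fintype ι] [DecidableEq ι] in
theorem add_vecMulVec_posDef [Finite ι] {R : Matrix ι ι ℝ} (hR : R.PosDef) (h : ι → ℝ) :
    (R + Matrix.vecMulVec h h).PosDef :=
  hR.add_posSemidef (by simpa using Matrix.posSemidef_vecMulVec_self_star h)

theorem one_add_dotProduct_inv_mulVec_pos {R : Matrix ι ι ℝ} (hR : R.PosDef) (h : ι → ℝ) :
    0 < 1 + h ⬝ᵥ (R⁻¹ *ᵥ h) := by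
  have quadratic_nonneg : 0 ≤ h ⬝ᵥ (R⁻¹ *ᵥ h) := by
    simpa using hR.inv.posSemidef.dotProduct_mulVec_nonneg h
  positivity

theorem add_vecMulVec_inv_mulVec {R : Matrix ι ι ℝ} (hR : R.PosDef) (h : ι → ℝ) :
    (R + Matrix.vecMulVec h h)⁻¹ *ᵥ h = (1 + h ⬝ᵥ (R⁻¹ *ᵥ h))⁻¹ • (R⁻¹ *ᵥ h) := by
  have factor (a : ℝ) : h + a • h = (1 + a) • h := by rw [add_smul, one_smul]
  have preimage : (R + Matrix.vecMulVec h h) *ᵥ ((1 + h ⬝ᵥ (R⁻¹ *ᵥ h))⁻¹ • (R⁻¹ *ᵥ h)) = h := by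
    rw [Matrix.mulVec_smul, Matrix.add_mulVec, Matrix.mulVec_mulVec,
      Matrix.mul_nonsing_inv _ (isUnit_det_of_posDef hR), Matrix.one_mulVec,
      Matrix.vecMulVec_mulVec, op_smul_eq_smul, factor, smul_smul,
      inv_mul_cancel₀ (one_add_dotProduct_inv_mulVec_pos hR h).ne', one_smul]
  calc (R + Matrix.vecMulVec h h)⁻¹ *ᵥ h
      = (R + Matrix.vecMulVec h h)⁻¹ *ᵥ ((R + Matrix.vecMulVec h h) *ᵥ
          ((1 + h ⬝ᵥ (R⁻¹ *ᵥ h))⁻¹ • (R⁻¹ *ᵥ h))) := by rw [preimage]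
    _ = _ := by
      rw [Matrix.mulVec_mulVec, Matrix.nonsing_inv_mul _
        (isUnit_det_of_posDef (add_vecMulVec_posDef hR h)), Matrix.one_mulVec]

end RankOne

namespace SMSNLMM

variable {n l q : ℕ} (θ : SMSNLMM n l q)

theorem Sig_posDef : θ.Sig.PosDef := θ.R_posDef.smul θ.sigmaSq_pos

theorem one_add_lam_pos : 0 < 1 + θ.lam ⬝ᵥ θ.lam := by
  have : 0 ≤ θ.lam ⬝ᵥ θ.lam := dotProduct_self_star_nonneg θ.lam
  positivity

theorem delta_dotProduct_delta_lt_one : θ.delta ⬝ᵥ θ.delta < 1 := by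
  have h := θ.one_add_lam_pos
  rw [delta, smul_dotProduct, dotProduct_smul, smul_smul, ← mul_inv,
    Real.mul_self_sqrt h.le, smul_eq_mul, inv_mul_lt_iff₀ h]
  linarith

theorem Gam_eq_sqrt_mul_mul_sqrt :
    θ.Gam = CFC.sqrt θ.D * (1 - Matrix.vecMulVec θ.delta θ.delta) * CFC.sqrt θ.D := by
  have sqrt_symm := transpose_eq_of_posDef (sqrt_posDef θ.D_posDef)
  have delta_vecMul : θ.delta ᵥ* CFC.sqrt θ.D = θ.Delta := by
    rw [← Matrix.mulVec_transpose, sqrt_symm, Delta]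
  rw [Matrix.mul_sub, Matrix.mul_one, Matrix.sub_mul, sqrt_mul_sqrt_of_posDef θ.D_posDef,
    Matrix.mul_vecMulVec, Matrix.vecMulVec_mul, delta_vecMul]
  rfl

theorem Gam_posDef : θ.Gam.PosDef := by
  have sqrt_D := sqrt_posDef θ.D_posDef
  rw [Gam_eq_sqrt_mul_mul_sqrt]
  simpa only [sqrt_D.isHermitian.eq] using
    (one_sub_vecMulVec_posDef θ.delta_dotProduct_delta_lt_one).conjTranspose_mul_mul_same
      (Matrix.mulVec_injective_of_isUnit sqrt_D.isUnit)

theorem B_posDef : θ.B.PosDef := posteriorCov_posDef θ.Gam_posDef θ.Sig_posDef θ.Z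

theorem Omega_posDef : θ.Omega.PosDef := add_mul_mul_transpose_posDef θ.Gam_posDef θ.Sig_posDef θ.Z

theorem Psi_posDef : θ.Psi.PosDef := add_mul_mul_transpose_posDef θ.D_posDef θ.Sig_posDef θ.Z

theorem Psi_eq : θ.Psi = θ.Omega + Matrix.vecMulVec (θ.Z *ᵥ θ.Delta) (θ.Z *ᵥ θ.Delta) := by
  rw [Omega, Psi, Gam, Matrix.mul_sub, Matrix.sub_mul, Matrix.mul_vecMulVec, Matrix.vecMulVec_mul,
    Matrix.vecMul_transpose]
  abel

theorem M_pos : 0 < θ.M :=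
  Real.rpow_pos_of_pos (one_add_dotProduct_inv_mulVec_pos θ.Omega_posDef _) _

theorem M_sq : θ.M ^ 2 = (1 + (θ.Z *ᵥ θ.Delta) ⬝ᵥ (θ.Omega⁻¹ *ᵥ (θ.Z *ᵥ θ.Delta)))⁻¹ := by
  rw [M, ← Real.rpow_natCast,
    ← Real.rpow_mul (one_add_dotProduct_inv_mulVec_pos θ.Omega_posDef _).le, ← Real.rpow_neg_one]
  norm_num

theorem Psi_inv_mulVec_Z_mulVec_Delta :
    θ.Psi⁻¹ *ᵥ (θ.Z *ᵥ θ.Delta) = θ.M ^ 2 • (θ.Omega⁻¹ *ᵥ (θ.Z *ᵥ θ.Delta)) := by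
  rw [Psi_eq, add_vecMulVec_inv_mulVec θ.Omega_posDef, M_sq]

theorem mu_eq_Z_mulVec_Delta_dotProduct (y : Fin n → ℝ) :
    θ.mu y = (θ.Z *ᵥ θ.Delta) ⬝ᵥ (θ.Psi⁻¹ *ᵥ (y - θ.loc)) := by
  rw [dotProduct_mulVec_comm_of_posDef θ.Psi_posDef.inv, Psi_inv_mulVec_Z_mulVec_Delta,
    dotProduct_smul, dotProduct_mulVec_comm_of_posDef θ.Omega_posDef.inv]
  rfl

theorem M_sq_add_quadratic :
    θ.M ^ 2 + (θ.Z *ᵥ θ.Delta) ⬝ᵥ (θ.Psi⁻¹ *ᵥ (θ.Z *ᵥ θ.Delta)) = 1 := by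
  have := one_add_dotProduct_inv_mulVec_pos θ.Omega_posDef (θ.Z *ᵥ θ.Delta)
  rw [Psi_inv_mulVec_Z_mulVec_Delta, dotProduct_smul, smul_eq_mul, M_sq]
  field_simp

theorem D_mulVec_zeta : θ.D *ᵥ θ.zeta = √(1 + θ.lam ⬝ᵥ θ.lam) • θ.Delta := by
  rw [Delta, delta, Matrix.mulVec_smul, smul_smul,
    mul_inv_cancel₀ (Real.sqrt_pos.2 θ.one_add_lam_pos).ne', one_smul, zeta, Matrix.mulVec_mulVec]
  nth_rw 1 [← sqrt_mul_sqrt_of_posDef θ.D_posDef]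
  rw [Matrix.mul_assoc,
    Matrix.mul_nonsing_inv _ (isUnit_det_of_posDef (sqrt_posDef θ.D_posDef)), Matrix.mul_one]

theorem zeta_dotProduct_D_mulVec_zeta : θ.zeta ⬝ᵥ (θ.D *ᵥ θ.zeta) = θ.lam ⬝ᵥ θ.lam := by
  have sqrt_D := sqrt_posDef θ.D_posDef
  have sqrt_mulVec_zeta : CFC.sqrt θ.D *ᵥ θ.zeta = θ.lam := by
    rw [zeta, Matrix.mulVec_mulVec, Matrix.mul_nonsing_inv _ (isUnit_det_of_posDef sqrt_D),
      Matrix.one_mulVec]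
  rw [← sqrt_mul_sqrt_of_posDef θ.D_posDef, ← Matrix.mulVec_mulVec, Matrix.dotProduct_mulVec,
    ← Matrix.mulVec_transpose, transpose_eq_of_posDef sqrt_D, sqrt_mulVec_zeta]

theorem one_add_zeta_dotProduct_Lam_mulVec_zeta :
    1 + θ.zeta ⬝ᵥ (θ.Lam *ᵥ θ.zeta) = (1 + θ.lam ⬝ᵥ θ.lam) * θ.M ^ 2 := by
  have Lam_eq : θ.Lam = θ.D - θ.D * θ.Zᵀ * θ.Psi⁻¹ * θ.Z * θ.D :=
    posteriorCov_eq_sub θ.D_posDef θ.Sig_posDef θ.Z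
  have quadratic : θ.zeta ⬝ᵥ ((θ.D * θ.Zᵀ * θ.Psi⁻¹ * θ.Z * θ.D) *ᵥ θ.zeta) =
      (1 + θ.lam ⬝ᵥ θ.lam) * ((θ.Z *ᵥ θ.Delta) ⬝ᵥ (θ.Psi⁻¹ *ᵥ (θ.Z *ᵥ θ.Delta))) := by
    simp only [Matrix.mul_assoc, ← Matrix.mulVec_mulVec, D_mulVec_zeta, Matrix.mulVec_smul]
    rw [dotProduct_smul, dotProduct_mulVec_comm_of_posDef θ.D_posDef, D_mulVec_zeta,
      dotProduct_smul, smul_smul, Real.mul_self_sqrt θ.one_add_lam_pos.le, smul_eq_mul,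
      Matrix.mulVec_transpose, ← Matrix.dotProduct_mulVec, dotProduct_comm _ (θ.Z *ᵥ θ.Delta)]
  rw [Lam_eq, Matrix.sub_mulVec, dotProduct_sub, quadratic, zeta_dotProduct_D_mulVec_zeta]
  linear_combination -(1 + θ.lam ⬝ᵥ θ.lam) * θ.M_sq_add_quadratic

theorem A_eq (y : Fin n → ℝ) :
    θ.A y = θ.lamBar ⬝ᵥ ((CFC.sqrt θ.Psi)⁻¹ *ᵥ (y - θ.loc)) := by
  have hlam := Real.sqrt_pos.2 θ.one_add_lam_pos
  have sqrt_one_add : √(1 + θ.zeta ⬝ᵥ (θ.Lam *ᵥ θ.zeta)) = √(1 + θ.lam ⬝ᵥ θ.lam) * θ.M := by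
    rw [one_add_zeta_dotProduct_Lam_mulVec_zeta, Real.sqrt_mul θ.one_add_lam_pos.le,
      Real.sqrt_sq θ.M_pos.le]
  rw [A, mu_eq_Z_mulVec_Delta_dotProduct, lamBar, sqrt_one_add, D_mulVec_zeta, smul_dotProduct,
    dotProduct_mulVec_comm_of_posDef (sqrt_posDef θ.Psi_posDef).inv, Matrix.mulVec_mulVec,
    sqrt_inv_mul_sqrt_inv θ.Psi_posDef, Matrix.mulVec_smul, Matrix.mulVec_smul, dotProduct_smul,
    smul_smul, smul_eq_mul, dotProduct_mulVec_comm_of_posDef θ.Psi_posDef.inv (y - θ.loc)]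
  field_simp

end SMSNLMM

/-! ### Conditional distributions -/

section ConditionalLaw

variable {Ω S E F G : Type*} [MeasurableSpace Ω] [MeasurableSpace S] [MeasurableSpace E]
  [MeasurableSpace F] [MeasurableSpace G] [StandardBorelSpace E] [Nonempty E]
  {P : Measure Ω} [IsFiniteMeasure P]

theorem CondLaw.ae_condDistrib [MeasurableSpace.CountablyGenerated S] [StandardBorelSpace G]
    [Nonempty G] {X : Ω → G} {Y : Ω → F} {v : G → E} {w : G → S} {κ : F × S → Measure E}
    (hX : Measurable X) (hY : Measurable Y) (hv : Measurable v) (hw : Measurable w)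
    (h : CondLaw (fun ω => v (X ω)) (fun ω => (Y ω, w (X ω))) P κ) :
    ∀ᵐ y ∂(P.map Y), CondLaw v w (condDistrib X Y P y) fun a => κ (y, a) := by
  set ξ := condDistrib X Y P
  set η := condDistrib (fun ω => v (X ω)) (fun ω => (Y ω, w (X ω))) P
  have joint_YX : (P.map Y) ⊗ₘ ξ = P.map fun ω => (Y ω, X ω) :=
    compProd_map_condDistrib hX.aemeasurable
  have joint_Yw : (P.map Y) ⊗ₘ ξ.map w = P.map fun ω => (Y ω, w (X ω)) := by
    rw [Measure.compProd_map hw, joint_YX, Measure.map_map (by fun_prop) (by fun_prop)]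
    rfl
  have disintegration : (P.map Y) ⊗ₘ ξ.map (fun x => (w x, v x)) =
      (P.map Y) ⊗ₘ (ξ.map w ⊗ₖ η) := by
    have joint_Ywv : (P.map fun ω => (Y ω, w (X ω))) ⊗ₘ η =
        P.map fun ω => ((Y ω, w (X ω)), v (X ω)) :=
      compProd_map_condDistrib (hv.comp hX).aemeasurable
    rw [Measure.compProd_map (hw.prodMk hv), joint_YX, ← Measure.compProd_assoc', joint_Yw,
      joint_Ywv, Measure.map_map (by fun_prop) (by fun_prop),
      Measure.map_map (by fun_prop) (by fun_prop)]
    rfl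
  have η_eq : ∀ᵐ y ∂(P.map Y), ∀ᵐ a ∂(ξ.map w y), η (y, a) = κ (y, a) :=
    Measure.ae_ae_of_ae_compProd (by rwa [joint_Yw])
  filter_upwards [Kernel.ae_eq_of_compProd_eq disintegration, η_eq] with y joint_eq η_eq_y
  rw [Kernel.map_apply _ (hw.prodMk hv), Kernel.compProd_apply_eq_compProd_sectR,
    Kernel.map_apply _ hw] at joint_eq
  rw [Kernel.map_apply _ hw] at η_eq_y
  filter_upwards [condDistrib_ae_eq_of_measure_eq_compProd w hv.aemeasurable joint_eq, η_eq_y]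
    with a h_sect h_eq
  rw [h_sect, Kernel.sectR_apply, h_eq]

theorem CondLaw.comp_measurableEquiv {V : Ω → E} {W : Ω → S} {κ : S → Measure E} (e : S ≃ᵐ F)
    (hV : Measurable V) (hW : Measurable W) (h : CondLaw V W P κ) :
    CondLaw V (fun ω => e (W ω)) P fun x => κ (e.symm x) := by
  set η := condDistrib V W P
  have map_eW : P.map (fun ω => e (W ω)) = (P.map W).map e :=
    (Measure.map_map e.measurable hW).symm
  have joint : P.map (fun ω => (e (W ω), V ω)) =
      P.map (fun ω => e (W ω)) ⊗ₘ η.comap e.symm e.symm.measurable := by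
    refine Measure.ext_of_lintegral _ fun f hf => ?_
    calc ∫⁻ p, f p ∂P.map (fun ω => (e (W ω), V ω))
        = ∫⁻ p, f (e p.1, p.2) ∂P.map (fun ω => (W ω, V ω)) := by
          rw [lintegral_map hf (by fun_prop), lintegral_map (by fun_prop) (by fun_prop)]
      _ = ∫⁻ w, ∫⁻ v, f (e w, v) ∂η w ∂P.map W := by
          rw [← compProd_map_condDistrib hV.aemeasurable, Measure.lintegral_compProd (by fun_prop)]
      _ = _ := by
          rw [Measure.lintegral_compProd hf, map_eW, lintegral_map_equiv]
          simp only [Kernel.comap_apply, e.symm_apply_apply]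
  have h_map : ∀ᵐ x ∂(P.map W).map e, η (e.symm x) = κ (e.symm x) := by
    refine (e.measurableEmbedding.ae_map_iff).2 ?_
    simpa only [e.symm_apply_apply, CondLaw] using h
  filter_upwards [condDistrib_ae_eq_of_measure_eq_compProd _ hV.aemeasurable joint,
    map_eW ▸ h_map] with x hx hx'
  rw [hx, Kernel.comap_apply, hx']

theorem CondLaw.integral_eq {V : Ω → E} {W : Ω → S} {κ : S → Measure E} (hV : Measurable V)
    (hW : Measurable W) (h : CondLaw V W P κ) {f : S × E → ℝ} (hf : Measurable f)
    (hint : Integrable (fun ω => f (W ω, V ω)) P) :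
    ∫ ω, f (W ω, V ω) ∂P = ∫ ω, ∫ v, f (W ω, v) ∂(κ (W ω)) ∂P := by
  have hint' : Integrable f ((P.map W) ⊗ₘ condDistrib V W P) := by
    rw [compProd_map_condDistrib hV.aemeasurable]
    exact (integrable_map_measure hf.aestronglyMeasurable (hW.prodMk hV).aemeasurable).2 hint
  calc ∫ ω, f (W ω, V ω) ∂P = ∫ p, f p ∂((P.map W) ⊗ₘ condDistrib V W P) := by
        rw [compProd_map_condDistrib hV.aemeasurable,
          integral_map (hW.prodMk hV).aemeasurable hf.aestronglyMeasurable]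
    _ = ∫ w, ∫ v, f (w, v) ∂(condDistrib V W P w) ∂(P.map W) := Measure.integral_compProd hint'
    _ = ∫ ω, ∫ v, f (W ω, v) ∂(condDistrib V W P (W ω)) ∂P :=
        integral_map hW.aemeasurable hf.stronglyMeasurable.integral_condDistrib.aestronglyMeasurable
    _ = ∫ ω, ∫ v, f (W ω, v) ∂(κ (W ω)) ∂P := by
        refine integral_congr_ae ?_
        filter_upwards [ae_of_ae_map hW.aemeasurable h] with ω hω
        rw [hω]

theorem CondLaw.integrable_integral {V : Ω → E} {W : Ω → S} {κ : S → Measure E}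
    (hV : Measurable V) (hW : Measurable W) (h : CondLaw V W P κ) {f : S × E → ℝ}
    (hf : Measurable f) (hint : Integrable (fun ω => f (W ω, V ω)) P) :
    Integrable (fun ω => ∫ v, f (W ω, v) ∂(κ (W ω))) P := by
  refine (Integrable.integral_condDistrib hW.aemeasurable hV.aemeasurable
    ((integrable_map_measure hf.aestronglyMeasurable
      (hW.prodMk hV).aemeasurable).2 hint)).congr ?_
  filter_upwards [ae_of_ae_map hW.aemeasurable h] with ω hω
  rw [hω]

theorem CondLaw.integrable_of_nonneg {V : Ω → E} {W : Ω → S} {κ : S → Measure E}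
    (hV : Measurable V) (hW : Measurable W) (h : CondLaw V W P κ) {f : S × E → ℝ}
    (hf : Measurable f) (hf0 : 0 ≤ f) (hint : ∀ᵐ w ∂(P.map W), Integrable (fun v => f (w, v)) (κ w))
    (hint' : Integrable (fun w => ∫ v, f (w, v) ∂(κ w)) (P.map W)) :
    Integrable (fun ω => f (W ω, V ω)) P := by
  refine (integrable_map_measure hf.aestronglyMeasurable (hW.prodMk hV).aemeasurable).1 <|
    (AEStronglyMeasurable.ae_integrable_condDistrib_map_iff hV.aemeasurable
      hf.aestronglyMeasurable).1 ⟨?_, hint'.congr ?_⟩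
  · filter_upwards [h, hint] with w hw hint_w
    rwa [hw]
  · filter_upwards [h] with w hw
    simp only [hw, Real.norm_of_nonneg (hf0 _)]

theorem ae_integrable_condDistrib [StandardBorelSpace G] [Nonempty G] {X : Ω → G} {Y : Ω → F}
    {f : F × G → ℝ} (hX : Measurable X) (hY : Measurable Y) (hf : Measurable f)
    (hint : Integrable (fun ω => f (Y ω, X ω)) P) :
    ∀ᵐ y ∂(P.map Y), Integrable (fun x => f (y, x)) (condDistrib X Y P y) :=
  MeasureTheory.Integrable.condDistrib_ae_map hX.aemeasurable <|
    (integrable_map_measure hf.aestronglyMeasurable (hY.prodMk hX).aemeasurable).2 hint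

theorem ae_condDistrib_of_ae [StandardBorelSpace G] [Nonempty G] {X : Ω → G} {Y : Ω → F}
    {p : G → Prop} (hX : Measurable X) (hY : Measurable Y) (hp : MeasurableSet {x | p x})
    (h : ∀ᵐ ω ∂P, p (X ω)) : ∀ᵐ y ∂(P.map Y), ∀ᵐ x ∂(condDistrib X Y P y), p x := by
  have joint : ∀ᵐ z ∂((P.map Y) ⊗ₘ condDistrib X Y P), p z.2 := by
    rw [compProd_map_condDistrib hX.aemeasurable]
    exact (ae_map_iff (hY.prodMk hX).aemeasurable (measurable_snd hp)).2 h
  exact Measure.ae_ae_of_ae_compProd joint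

end ConditionalLaw

/-! ### Conditional distributions in the model -/

section BayesRule

open Function

variable {Ω S : Type*} [MeasurableSpace Ω] [MeasurableSpace S] {P : Measure Ω} [IsFiniteMeasure P]
  {n q : ℕ}

theorem measurable_mulVec {ι κ : Type*} [Countable ι] [Fintype κ] {f : S → κ → ℝ} (A : Matrix ι κ ℝ)
    (hf : Measurable f) : Measurable fun w => A *ᵥ f w :=
  (by fun_prop : Continuous fun x : κ → ℝ => A *ᵥ x).measurable.comp hf

theorem condLaw_multivariateGaussian_iff {V : Ω → EuclideanSpace ℝ (Fin q)} {W : Ω → S}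
    {m : S → Fin q → ℝ} {v : S → ℝ} {C : Matrix (Fin q) (Fin q) ℝ} (hC : C.PosDef)
    (hV : Measurable V) (hm : Measurable m) (hv : Measurable v) (hv0 : ∀ᵐ w ∂(P.map W), 0 < v w) :
    CondLaw V W P (fun w => multivariateGaussian (WithLp.toLp 2 (m w)) (v w • C)) ↔
      HasCondDensity V W P volume fun w x => normalPDF (m w) (v w • C) x.ofLp := by
  refine condLaw_iff_hasCondDensity hV ?_ ?_ (.of_forall fun w => inferInstance)
  · exact measurable_normalPDF_smul hC (hm.comp measurable_fst) (hv.comp measurable_fst)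
      (by fun_prop)
  · filter_upwards [hv0] with w hw using multivariateGaussian_eq_withDensity (hC.smul hw) (m w)

theorem condLaw_truncNormal_iff {V : Ω → ℝ} {W : Ω → S} {m v : S → ℝ} {c : ℝ} (hV : Measurable V)
    (hm : Measurable m) (hv : Measurable v) (hv0 : ∀ᵐ w ∂(P.map W), 0 < v w) :
    CondLaw V W P (fun w => truncNormal (m w) (v w) (Ioi c)) ↔
      HasCondDensity V W P volume fun w => truncNormalPDF (m w) (v w) c := by
  refine condLaw_iff_hasCondDensity hV ?_ ?_ ?_
  · exact measurable_truncNormalPDF (hm.comp measurable_fst) (hv.comp measurable_fst)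
      measurable_snd c
  · filter_upwards [hv0] with w hw using truncNormal_Ioi_eq_withDensity (m w) c hw
  · filter_upwards [hv0] with w hw using isProbabilityMeasure_truncNormal_Ioi (m w) c hw

theorem lintegral_normalPDF {C : Matrix (Fin q) (Fin q) ℝ} (hC : C.PosDef) (m : Fin q → ℝ) :
    ∫⁻ x : EuclideanSpace ℝ (Fin q), ENNReal.ofReal (normalPDF m C x.ofLp) = 1 := by
  rw [← setLIntegral_univ, ← withDensity_apply _ MeasurableSet.univ,
    ← multivariateGaussian_eq_withDensity hC, measure_univ]

theorem lintegral_truncNormalPDF (m c : ℝ) {v : ℝ} (hv : 0 < v) :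
    ∫⁻ t, ENNReal.ofReal (truncNormalPDF m v c t) = 1 := by
  have := isProbabilityMeasure_truncNormal_Ioi m c hv
  rw [← setLIntegral_univ, ← withDensity_apply _ MeasurableSet.univ,
    ← truncNormal_Ioi_eq_withDensity m c hv, measure_univ]

theorem normalPDF_smul_mul_normalPDF_smul {C : Matrix (Fin q) (Fin q) ℝ}
    {R : Matrix (Fin n) (Fin n) ℝ} (hC : C.PosDef) (hR : R.PosDef) (Z : Matrix (Fin n) (Fin q) ℝ)
    {v : ℝ} (hv : 0 < v) (m b : Fin q → ℝ) (a y : Fin n → ℝ) :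
    normalPDF m (v • C) b * normalPDF (a + Z *ᵥ b) (v • R) y =
      normalPDF (a + Z *ᵥ m) (v • (R + Z * C * Zᵀ)) y *
        normalPDF (m + (posteriorCov C R Z * Zᵀ * R⁻¹) *ᵥ (y - (a + Z *ᵥ m)))
          (v • posteriorCov C R Z) b := by
  have gain : (v • posteriorCov C R Z) * Zᵀ * (v • R)⁻¹ = posteriorCov C R Z * Zᵀ * R⁻¹ := by
    rw [inv_smul_of_isUnit_det (isUnit_det_of_posDef hR), Matrix.smul_mul, Matrix.smul_mul,
      Matrix.mul_smul, smul_smul, mul_inv_cancel₀ hv.ne', one_smul]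
  rw [normalPDF_mul_normalPDF (hC.smul hv) (hR.smul hv), posteriorCov_smul hC hR, gain,
    Matrix.mul_smul, Matrix.smul_mul, ← smul_add]

theorem HasCondDensity.normal_of_linear {X : Ω → EuclideanSpace ℝ (Fin q)}
    {Y : Ω → EuclideanSpace ℝ (Fin n)} {W : Ω → S} {m : S → Fin q → ℝ} {a : S → Fin n → ℝ}
    {v : S → ℝ} {C : Matrix (Fin q) (Fin q) ℝ} {R : Matrix (Fin n) (Fin n) ℝ}
    (hC : C.PosDef) (hR : R.PosDef) (Z : Matrix (Fin n) (Fin q) ℝ)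
    (hX : Measurable X) (hY : Measurable Y) (hW : Measurable W)
    (hm : Measurable m) (ha : Measurable a) (hv : Measurable v) (hv0 : ∀ᵐ w ∂(P.map W), 0 < v w)
    (hXW : HasCondDensity X W P volume fun w x => normalPDF (m w) (v w • C) x.ofLp)
    (hYXW : HasCondDensity Y (fun ω => (X ω, W ω)) P volume fun w y =>
      normalPDF (a w.2 + Z *ᵥ w.1.ofLp) (v w.2 • R) y.ofLp) :
    HasCondDensity Y W P volume (fun w y =>
        normalPDF (a w + Z *ᵥ m w) (v w • (R + Z * C * Zᵀ)) y.ofLp) ∧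
      HasCondDensity X (fun ω => (W ω, Y ω)) P volume fun w x =>
        normalPDF (m w.1 + (posteriorCov C R Z * Zᵀ * R⁻¹) *ᵥ (w.2.ofLp - (a w.1 + Z *ᵥ m w.1)))
          (v w.1 • posteriorCov C R Z) x.ofLp := by
  have := measurable_mulVec Z hm
  refine HasCondDensity.of_mul_eq hW hX hY ?_ ?_ ?_ ?_ (fun _ _ => normalPDF_nonneg _ _ _)
    (fun _ _ => normalPDF_nonneg _ _ _) hXW hYXW ?_ ?_
  · exact measurable_normalPDF_smul hC (by fun_prop) (by fun_prop) (by fun_prop)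
  · exact measurable_normalPDF_smul hR
      ((ha.comp (by fun_prop)).add (measurable_mulVec Z (by fun_prop))) (by fun_prop) (by fun_prop)
  · exact measurable_normalPDF_smul (add_mul_mul_transpose_posDef hC hR Z) (by fun_prop)
      (by fun_prop) (by fun_prop)
  · exact measurable_normalPDF_smul (posteriorCov_posDef hC hR Z)
      ((hm.comp (by fun_prop)).add (measurable_mulVec _ (by fun_prop))) (by fun_prop) (by fun_prop)
  · filter_upwards [hv0] with w hw x y
    exact normalPDF_smul_mul_normalPDF_smul hC hR Z hw _ _ _ _
  · filter_upwards [hv0] with w hw y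
    exact lintegral_normalPDF ((posteriorCov_posDef hC hR Z).smul hw) _

theorem truncNormalPDF_mul_normalPDF {R : Matrix (Fin n) (Fin n) ℝ} (hR : R.PosDef) {v : ℝ}
    (hv : 0 < v) (m c t : ℝ) (h a y : Fin n → ℝ) {m' v' : ℝ}
    (hm' : m' = m + (1 + h ⬝ᵥ (R⁻¹ *ᵥ h))⁻¹ * (h ⬝ᵥ (R⁻¹ *ᵥ (y - (a + m • h)))))
    (hv' : v' = v * (1 + h ⬝ᵥ (R⁻¹ *ᵥ h))⁻¹) :
    truncNormalPDF m v c t * normalPDF (a + t • h) (v • R) y =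
      normalPDF (a + m • h) (v • (R + Matrix.vecMulVec h h)) y *
          (stdNormalCDF ((m' - c) / √v') / stdNormalCDF ((m - c) / √v)) *
        truncNormalPDF m' v' c t := by
  have inv_smul_R := inv_smul_of_isUnit_det (isUnit_det_of_posDef hR) v
  have precision : (v⁻¹ + h ⬝ᵥ ((v • R)⁻¹ *ᵥ h))⁻¹ = v' := by
    rw [hv', inv_smul_R, Matrix.smul_mulVec, dotProduct_smul, smul_eq_mul, ← mul_one_add, mul_inv,
      inv_inv]
  have mean : m + v' * (h ⬝ᵥ ((v • R)⁻¹ *ᵥ (y - (a + m • h)))) = m' := by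
    rw [hm', hv', inv_smul_R, Matrix.smul_mulVec, dotProduct_smul, smul_eq_mul]
    field_simp
  have bayes := gaussianPDFReal_mul_normalPDF (hR.smul hv) hv h a y m t
  rw [precision, mean, ← smul_add] at bayes
  have hΦ := (stdNormalCDF_pos ((m - c) / √v)).ne'
  have hΦ' := (stdNormalCDF_pos ((m' - c) / √v')).ne'
  by_cases ht : t ∈ Ioi c
  · rw [truncNormalPDF, truncNormalPDF, indicator_of_mem ht, indicator_of_mem ht]
    field_simp
    exact bayes
  · rw [truncNormalPDF, truncNormalPDF, indicator_of_notMem ht, indicator_of_notMem ht, zero_mul,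
      mul_zero]

end BayesRule

instance isProbabilityMeasure_condLatent {Ω : Type*} [MeasurableSpace Ω] {n q : ℕ} (P : Measure Ω)
    [IsFiniteMeasure P] (U T : Ω → ℝ) (b : Ω → EuclideanSpace ℝ (Fin q))
    (Y : Ω → EuclideanSpace ℝ (Fin n)) (y : EuclideanSpace ℝ (Fin n)) :
    IsProbabilityMeasure (condLatent P U T b Y y) := by
  unfold condLatent
  infer_instance

namespace SMSNLMM

variable {n l q : ℕ} (θ : SMSNLMM n l q)

@[fun_prop]
theorem measurable_r : Measurable θ.r := by
  have : Continuous θ.r := by unfold r; fun_prop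
  exact this.measurable

@[fun_prop]
theorem measurable_mu : Measurable θ.mu := by
  have : Continuous θ.mu := by unfold mu dotProduct; fun_prop
  exact this.measurable

@[fun_prop]
theorem measurable_A : Measurable θ.A := θ.measurable_mu.div_const _

theorem smul_s_add_r (t : ℝ) (y : Fin n → ℝ) :
    t • θ.s + θ.r y = t • θ.Delta +
      (θ.B * θ.Zᵀ * θ.Sig⁻¹) *ᵥ (y - (θ.X *ᵥ θ.β + θ.Z *ᵥ (t • θ.Delta))) := by
  rw [s, r, Matrix.sub_mulVec, Matrix.one_mulVec, ← sub_sub, Matrix.mulVec_sub _ _ (θ.Z *ᵥ _),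
    Matrix.mulVec_smul, Matrix.mulVec_smul, Matrix.mulVec_mulVec, smul_sub]
  abel

theorem truncNormalPDF_mul_normalPDF_Omega {u : ℝ} (hu : 0 < u) (t : ℝ) (y : Fin n → ℝ) :
    truncNormalPDF θ.c u⁻¹ θ.c t * normalPDF (θ.X *ᵥ θ.β + t • (θ.Z *ᵥ θ.Delta)) (u⁻¹ • θ.Omega) y =
      2 * (normalPDF θ.loc (u⁻¹ • θ.Psi) y * stdNormalCDF (√u * θ.A y)) *
        truncNormalPDF (θ.c + θ.mu y) (u⁻¹ * θ.M ^ 2) θ.c t := by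
  have bayes := truncNormalPDF_mul_normalPDF θ.Omega_posDef (inv_pos.2 hu) θ.c θ.c t
    (θ.Z *ᵥ θ.Delta) (θ.X *ᵥ θ.β) y (m' := θ.c + θ.mu y) (v' := u⁻¹ * θ.M ^ 2)
    (by rw [mu, M_sq, loc]) (by rw [M_sq])
  rw [sub_self, zero_div, stdNormalCDF_zero, add_sub_cancel_left,
    div_sqrt_inv_mul_sq _ _ θ.M_pos, ← A, ← Psi_eq, ← loc] at bayes
  rw [bayes]
  ring

namespace IsModel

variable {θ} {Ω : Type*} [MeasurableSpace Ω] {P : Measure Ω} [IsProbabilityMeasure P]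
  {U T : Ω → ℝ} {b : Ω → EuclideanSpace ℝ (Fin q)} {Y : Ω → EuclideanSpace ℝ (Fin n)}

theorem ae_U_pos (h : θ.IsModel P U T b Y) : ∀ᵐ ω ∂P, 0 < U ω :=
  ae_of_ae_map h.measurable_U.aemeasurable (h.law_U ▸ θ.H_pos)

theorem ae_map_inv_pos {S : Type*} [MeasurableSpace S] {W : Ω → S} {u : S → ℝ}
    (h : θ.IsModel P U T b Y) (hW : Measurable W) (hu : Measurable u) (huW : ∀ ω, u (W ω) = U ω) :
    ∀ᵐ w ∂P.map W, 0 < (u w)⁻¹ := by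
  refine (ae_map_iff hW.aemeasurable (hu.inv measurableSet_Ioi)).2 ?_
  filter_upwards [h.ae_U_pos] with ω hω
  rwa [mem_Ioi, Pi.inv_apply, huW, inv_pos]

theorem hasCondDensity_Y_b (h : θ.IsModel P U T b Y) :
    HasCondDensity Y (fun ω => (T ω, U ω)) P volume (fun w y =>
        normalPDF (θ.X *ᵥ θ.β + w.1 • (θ.Z *ᵥ θ.Delta)) (w.2⁻¹ • θ.Omega) y.ofLp) ∧
      HasCondDensity b (fun ω => ((T ω, U ω), Y ω)) P volume fun w x =>
        normalPDF (w.1.1 • θ.s + θ.r w.2.ofLp) (w.1.2⁻¹ • θ.B) x.ofLp := by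
  obtain ⟨hU, hT, hb, hY, -, -, law_b, law_Y⟩ := id h
  have inv_U_pos : ∀ᵐ w ∂P.map (fun ω => (T ω, U ω)), 0 < w.2⁻¹ :=
    h.ae_map_inv_pos (by fun_prop) measurable_snd fun _ => rfl
  have inv_U_pos' : ∀ᵐ w ∂P.map (fun ω => (b ω, T ω, U ω)), 0 < w.2.2⁻¹ :=
    h.ae_map_inv_pos (by fun_prop) (measurable_snd.comp measurable_snd) fun _ => rfl
  have density_b := (condLaw_multivariateGaussian_iff θ.Gam_posDef hb (by fun_prop) (by fun_prop)
    inv_U_pos).1 law_b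
  have density_Y := (condLaw_multivariateGaussian_iff θ.Sig_posDef hY
    (measurable_const.add (measurable_mulVec θ.Z (by fun_prop))) (by fun_prop) inv_U_pos').1 law_Y
  have bayes := HasCondDensity.normal_of_linear (W := fun ω => (T ω, U ω))
    (m := fun w => w.1 • θ.Delta) (a := fun _ => θ.X *ᵥ θ.β) (v := fun w => w.2⁻¹)
    θ.Gam_posDef θ.Sig_posDef θ.Z hb hY (by fun_prop) (by fun_prop) (by fun_prop) (by fun_prop)
    inv_U_pos density_b density_Y
  simp only [smul_s_add_r, ← Matrix.mulVec_smul]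
  exact bayes

theorem hasCondDensity_Y_T (h : θ.IsModel P U T b Y) :
    HasCondDensity Y U P volume (fun u y =>
        2 * (normalPDF θ.loc (u⁻¹ • θ.Psi) y.ofLp * stdNormalCDF (√u * θ.A y.ofLp))) ∧
      HasCondDensity T (fun ω => (U ω, Y ω)) P volume fun w =>
        truncNormalPDF (θ.c + θ.mu w.2.ofLp) (w.1⁻¹ * θ.M ^ 2) θ.c := by
  have hU := h.measurable_U
  have density_T := (condLaw_truncNormal_iff h.measurable_T measurable_const (by fun_prop)
    (h.ae_map_inv_pos hU measurable_id fun _ => rfl)).1 h.law_T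
  refine HasCondDensity.of_mul_eq hU h.measurable_T h.measurable_Y ?_ ?_ ?_ ?_
    (fun _ _ => truncNormalPDF_nonneg _ _ _ _) (fun u y => ?_) density_T h.hasCondDensity_Y_b.1
    ?_ ?_
  · exact measurable_truncNormalPDF (by fun_prop) (by fun_prop) (by fun_prop) _
  · exact measurable_normalPDF_smul θ.Omega_posDef (by fun_prop) (by fun_prop) (by fun_prop)
  · exact measurable_const.mul ((measurable_normalPDF_smul θ.Psi_posDef (by fun_prop) (by fun_prop)
      (by fun_prop)).mul (by fun_prop))
  · exact measurable_truncNormalPDF (by fun_prop) (by fun_prop) (by fun_prop) _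
  · have := normalPDF_nonneg θ.loc (u⁻¹ • θ.Psi) y.ofLp
    have := (stdNormalCDF_pos (√u * θ.A y.ofLp)).le
    positivity
  · filter_upwards [h.law_U ▸ θ.H_pos] with u hu t y
    exact θ.truncNormalPDF_mul_normalPDF_Omega hu t y.ofLp
  · filter_upwards [h.law_U ▸ θ.H_pos] with u hu y
    exact lintegral_truncNormalPDF _ _ (mul_pos (inv_pos.2 hu) (pow_pos θ.M_pos 2))

theorem condLaw_b_of_T_U_Y (h : θ.IsModel P U T b Y) :
    CondLaw b (fun ω => ((T ω, U ω), Y ω)) P fun w =>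
      multivariateGaussian (WithLp.toLp 2 (w.1.1 • θ.s + θ.r w.2.ofLp)) (w.1.2⁻¹ • θ.B) := by
  obtain ⟨hU, hT, hb, hY, -⟩ := id h
  have inv_U_pos : ∀ᵐ w ∂P.map (fun ω => ((T ω, U ω), Y ω)), 0 < w.1.2⁻¹ :=
    h.ae_map_inv_pos (by fun_prop) (measurable_snd.comp measurable_fst) fun _ => rfl
  exact (condLaw_multivariateGaussian_iff θ.B_posDef hb (by fun_prop) (by fun_prop)
    inv_U_pos).2 h.hasCondDensity_Y_b.2

theorem condLaw_T_of_U_Y (h : θ.IsModel P U T b Y) : CondLaw T (fun ω => (U ω, Y ω)) P fun w =>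
    truncNormal (θ.c + θ.mu w.2.ofLp) (w.1⁻¹ * θ.M ^ 2) (Ioi θ.c) := by
  obtain ⟨hU, hT, -, hY, -⟩ := id h
  refine (condLaw_truncNormal_iff hT (by fun_prop) (by fun_prop) ?_).2 h.hasCondDensity_Y_T.2
  filter_upwards [h.ae_map_inv_pos (hU.prodMk hY) measurable_fst fun _ => rfl] with w hw
  exact mul_pos hw (pow_pos θ.M_pos 2)

theorem map_Y (h : θ.IsModel P U T b Y) : P.map Y = smsn θ.loc θ.Psi θ.lamBar θ.H := by
  have restrict_H : θ.H.restrict (Ioi 0) = θ.H := Measure.restrict_eq_self_of_ae_mem θ.H_pos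
  have hk : Measurable (Function.uncurry fun (u : ℝ) (y : EuclideanSpace ℝ (Fin n)) =>
      2 * (normalPDF θ.loc (u⁻¹ • θ.Psi) y.ofLp * stdNormalCDF (√u * θ.A y.ofLp))) :=
    measurable_const.mul ((measurable_normalPDF_smul θ.Psi_posDef (by fun_prop) (by fun_prop)
      (by fun_prop)).mul (by fun_prop))
  rw [h.hasCondDensity_Y_T.1.map_eq_withDensity h.measurable_Y h.measurable_U hk, h.law_U, smsn]
  congr 1 with y
  simp only [smsnPDF, restrict_H, ← A_eq, ENNReal.ofReal_mul zero_le_two, ENNReal.ofReal_ofNat]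
  exact lintegral_const_mul' _ _ ENNReal.ofNat_ne_top

theorem ae_condLatent_condLaw_T (h : θ.IsModel P U T b Y) : ∀ᵐ y ∂P.map Y,
    CondLaw (fun z => z.2.1) (fun z => z.1) (condLatent P U T b Y y) fun u =>
      truncNormal (θ.c + θ.mu y.ofLp) (u⁻¹ * θ.M ^ 2) (Ioi θ.c) := by
  obtain ⟨hU, hT, hb, hY, -⟩ := id h
  have reordered : CondLaw T (fun ω => (Y ω, U ω)) P fun w =>
      truncNormal (θ.c + θ.mu w.1.ofLp) (w.2⁻¹ * θ.M ^ 2) (Ioi θ.c) :=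
    h.condLaw_T_of_U_Y.comp_measurableEquiv MeasurableEquiv.prodComm hT (hU.prodMk hY)
  have latent_measurable : Measurable fun ω => (U ω, T ω, b ω) := by fun_prop
  exact (CondLaw.ae_condDistrib latent_measurable hY (v := fun z => z.2.1) (by fun_prop)
    measurable_fst reordered :)

theorem ae_condLatent_condLaw_b (h : θ.IsModel P U T b Y) : ∀ᵐ y ∂P.map Y,
    CondLaw (fun z => z.2.2) (fun z => (z.2.1, z.1)) (condLatent P U T b Y y) fun w =>
      multivariateGaussian (WithLp.toLp 2 (w.1 • θ.s + θ.r y.ofLp)) (w.2⁻¹ • θ.B) := by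
  obtain ⟨hU, hT, hb, hY, -⟩ := id h
  have reordered : CondLaw b (fun ω => (Y ω, (T ω, U ω))) P fun w =>
      multivariateGaussian (WithLp.toLp 2 (w.2.1 • θ.s + θ.r w.1.ofLp)) (w.2.2⁻¹ • θ.B) :=
    h.condLaw_b_of_T_U_Y.comp_measurableEquiv MeasurableEquiv.prodComm hb
      ((hT.prodMk hU).prodMk hY)
  have latent_measurable : Measurable fun ω => (U ω, T ω, b ω) := by fun_prop
  exact (CondLaw.ae_condDistrib latent_measurable hY (v := fun z => z.2.2) (by fun_prop)
    (w := fun z => (z.2.1, z.1)) (by fun_prop) reordered :)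

end IsModel

end SMSNLMM

/-! ### Conditional moments -/

section ConditionalMoments

theorem memLp_eval_multivariateGaussian {p : ℕ} (m : EuclideanSpace ℝ (Fin p))
    (S : Matrix (Fin p) (Fin p) ℝ) (j : Fin p) :
    MemLp (fun x : EuclideanSpace ℝ (Fin p) => x j) 2 (multivariateGaussian m S) :=
  (IsGaussian.memLp_two_id (μ := multivariateGaussian m S)).continuousLinearMap_comp
    (EuclideanSpace.proj (𝕜 := ℝ) j)

theorem integral_eval_multivariateGaussian {p : ℕ} (m : EuclideanSpace ℝ (Fin p))
    (S : Matrix (Fin p) (Fin p) ℝ) (j : Fin p) :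
    ∫ x, x j ∂(multivariateGaussian m S) = m j := by
  have h := (EuclideanSpace.proj (𝕜 := ℝ) j).integral_comp_comm
    ((IsGaussian.memLp_two_id (μ := multivariateGaussian m S)).integrable (by norm_num))
  simpa using h

theorem integral_eval_mul_eval_multivariateGaussian {p : ℕ} (m : EuclideanSpace ℝ (Fin p))
    {S : Matrix (Fin p) (Fin p) ℝ} (hS : S.PosSemidef) (j k : Fin p) :
    ∫ x, x j * x k ∂(multivariateGaussian m S) = m j * m k + S j k := by
  have h := covariance_eval_multivariateGaussian (μ := m) hS j k
  rw [covariance_eq_sub (memLp_eval_multivariateGaussian m S j)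
    (memLp_eval_multivariateGaussian m S k), integral_eval_multivariateGaussian,
    integral_eval_multivariateGaussian] at h
  simp only [Pi.mul_apply] at h
  linarith

variable {q : ℕ} {Q : Measure (ℝ × ℝ × EuclideanSpace ℝ (Fin q))} [IsProbabilityMeasure Q]

section TruncatedNormal

variable {μ c τ : ℝ}

theorem integrable_sqrt_mul_WPhi (hτ : 0 < τ) (hpos : ∀ᵐ z ∂Q, 0 < z.1)
    (h : CondLaw (fun z => z.2.1) (fun z => z.1) Q fun u =>
      truncNormal (c + μ) (u⁻¹ * τ ^ 2) (Ioi c))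
    (hu : Integrable (fun z => z.1) Q) (hut : Integrable (fun z => z.1 * z.2.1) Q) :
    Integrable (fun z => √z.1 * WPhi (√z.1 * (μ / τ))) Q := by
  have hcond := h.integrable_integral (f := fun p => p.1 * p.2) (by fun_prop) (by fun_prop)
    (by fun_prop) hut
  refine ((hcond.sub (hu.const_mul (μ + c))).const_mul τ⁻¹).congr ?_
  filter_upwards [hpos] with z hz
  rw [Pi.sub_apply, integral_const_mul, mul_integral_id_truncNormal_Ioi μ c hz hτ,
    add_sub_cancel_left, inv_mul_cancel_left₀ hτ.ne']

theorem utHat_eq_of_condLaw_truncNormal (hτ : 0 < τ) (hpos : ∀ᵐ z ∂Q, 0 < z.1)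
    (h : CondLaw (fun z => z.2.1) (fun z => z.1) Q fun u =>
      truncNormal (c + μ) (u⁻¹ * τ ^ 2) (Ioi c))
    (hu : Integrable (fun z => z.1) Q) (hut : Integrable (fun z => z.1 * z.2.1) Q) :
    utHat Q = (μ + c) * uHat Q + τ * tauOneHat Q (μ / τ) := by
  have hW := integrable_sqrt_mul_WPhi hτ hpos h hu hut
  calc utHat Q = ∫ z, ∫ t, z.1 * t ∂truncNormal (c + μ) (z.1⁻¹ * τ ^ 2) (Ioi c) ∂Q :=
        h.integral_eq (f := fun p => p.1 * p.2) (by fun_prop) (by fun_prop) (by fun_prop) hut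
    _ = ∫ z, ((μ + c) * z.1 + τ * (√z.1 * WPhi (√z.1 * (μ / τ)))) ∂Q := by
        refine integral_congr_ae ?_
        filter_upwards [hpos] with z hz
        rw [integral_const_mul, mul_integral_id_truncNormal_Ioi μ c hz hτ]
    _ = (μ + c) * uHat Q + τ * tauOneHat Q (μ / τ) := by
        rw [integral_add (hu.const_mul _) (hW.const_mul _), integral_const_mul, integral_const_mul,
          uHat, tauOneHat]

theorem utSqHat_eq_of_condLaw_truncNormal (hτ : 0 < τ) (hpos : ∀ᵐ z ∂Q, 0 < z.1)
    (h : CondLaw (fun z => z.2.1) (fun z => z.1) Q fun u =>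
      truncNormal (c + μ) (u⁻¹ * τ ^ 2) (Ioi c))
    (hu : Integrable (fun z => z.1) Q) (hut : Integrable (fun z => z.1 * z.2.1) Q)
    (hutSq : Integrable (fun z => z.1 * z.2.1 ^ 2) Q) :
    utSqHat Q = τ ^ 2 + (μ + c) ^ 2 * uHat Q + τ * (μ + 2 * c) * tauOneHat Q (μ / τ) := by
  have hW := integrable_sqrt_mul_WPhi hτ hpos h hu hut
  have hconst : Integrable (fun _ => τ ^ 2) Q := integrable_const _
  calc utSqHat Q = ∫ z, ∫ t, z.1 * t ^ 2 ∂truncNormal (c + μ) (z.1⁻¹ * τ ^ 2) (Ioi c) ∂Q :=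
        h.integral_eq (f := fun p => p.1 * p.2 ^ 2) (by fun_prop) (by fun_prop) (by fun_prop) hutSq
    _ = ∫ z, (τ ^ 2 + (μ + c) ^ 2 * z.1 +
          τ * (μ + 2 * c) * (√z.1 * WPhi (√z.1 * (μ / τ)))) ∂Q := by
        refine integral_congr_ae ?_
        filter_upwards [hpos] with z hz
        rw [integral_const_mul, mul_integral_sq_truncNormal_Ioi μ c hz hτ]
    _ = τ ^ 2 + (μ + c) ^ 2 * uHat Q + τ * (μ + 2 * c) * tauOneHat Q (μ / τ) := by
        rw [integral_add (f := fun z => _ + _) (hconst.add (hu.const_mul _)) (hW.const_mul _),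
          integral_add hconst (hu.const_mul _), integral_const_mul, integral_const_mul,
          integral_const, probReal_univ, one_smul, uHat, tauOneHat]

end TruncatedNormal

section Normal

variable {r s : Fin q → ℝ} {B : Matrix (Fin q) (Fin q) ℝ}

theorem integral_mul_eval_of_condLaw_multivariateGaussian {φ : ℝ × ℝ → ℝ} (hφ : Measurable φ)
    (h : CondLaw (fun z => z.2.2) (fun z => (z.2.1, z.1)) Q fun w =>
      multivariateGaussian (WithLp.toLp 2 (w.1 • s + r)) (w.2⁻¹ • B))
    (hint : Integrable (fun z => φ (z.2.1, z.1)) Q)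
    (hint_t : Integrable (fun z => φ (z.2.1, z.1) * z.2.1) Q) {j : Fin q}
    (hint_b : Integrable (fun z => φ (z.2.1, z.1) * z.2.2 j) Q) :
    ∫ z, φ (z.2.1, z.1) * z.2.2 j ∂Q =
      (∫ z, φ (z.2.1, z.1) ∂Q) * r j + (∫ z, φ (z.2.1, z.1) * z.2.1 ∂Q) * s j := by
  rw [h.integral_eq (f := fun p => φ p.1 * p.2 j) (by fun_prop) (by fun_prop) (by fun_prop) hint_b,
    ← integral_mul_const, ← integral_mul_const,
    ← integral_add (hint.mul_const _) (hint_t.mul_const _)]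
  refine integral_congr_ae (Filter.Eventually.of_forall fun z => ?_)
  dsimp only
  rw [integral_const_mul, integral_eval_multivariateGaussian]
  simp only [Pi.add_apply, Pi.smul_apply, smul_eq_mul]
  ring

theorem ubHat_eq_of_condLaw_multivariateGaussian
    (h : CondLaw (fun z => z.2.2) (fun z => (z.2.1, z.1)) Q fun w =>
      multivariateGaussian (WithLp.toLp 2 (w.1 • s + r)) (w.2⁻¹ • B))
    (hu : Integrable (fun z => z.1) Q) (hut : Integrable (fun z => z.1 * z.2.1) Q)
    (hub : ∀ j, Integrable (fun z => z.1 * z.2.2 j) Q) :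
    ubHat Q = uHat Q • r + utHat Q • s :=
  funext fun j =>
    integral_mul_eval_of_condLaw_multivariateGaussian measurable_snd h hu hut (hub j)

theorem utbHat_eq_of_condLaw_multivariateGaussian
    (h : CondLaw (fun z => z.2.2) (fun z => (z.2.1, z.1)) Q fun w =>
      multivariateGaussian (WithLp.toLp 2 (w.1 • s + r)) (w.2⁻¹ • B))
    (hut : Integrable (fun z => z.1 * z.2.1) Q) (hutSq : Integrable (fun z => z.1 * z.2.1 ^ 2) Q)
    (hutb : ∀ j, Integrable (fun z => z.1 * z.2.1 * z.2.2 j) Q) :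
    utbHat Q = utHat Q • r + utSqHat Q • s := by
  simp only [sq, ← mul_assoc] at hutSq
  ext j
  simp only [utSqHat, sq, ← mul_assoc]
  exact integral_mul_eval_of_condLaw_multivariateGaussian (measurable_snd.mul measurable_fst) h
    hut hutSq (hutb j)

theorem ubbHat_eq_of_condLaw_multivariateGaussian (hB : B.PosSemidef) (hpos : ∀ᵐ z ∂Q, 0 < z.1)
    (h : CondLaw (fun z => z.2.2) (fun z => (z.2.1, z.1)) Q fun w =>
      multivariateGaussian (WithLp.toLp 2 (w.1 • s + r)) (w.2⁻¹ • B))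
    (hu : Integrable (fun z => z.1) Q) (hut : Integrable (fun z => z.1 * z.2.1) Q)
    (hutSq : Integrable (fun z => z.1 * z.2.1 ^ 2) Q)
    (hubb : ∀ j k, Integrable (fun z => z.1 * (z.2.2 j * z.2.2 k)) Q) :
    ubbHat Q = B + uHat Q • Matrix.vecMulVec r r +
      utHat Q • (Matrix.vecMulVec s r + Matrix.vecMulVec r s) +
      utSqHat Q • Matrix.vecMulVec s s := by
  ext j k
  have hconst : Integrable (fun _ => B j k) Q := integrable_const _
  have hu_rr := hu.mul_const (r j * r k)
  have hut_sr := hut.mul_const (s j * r k + r j * s k)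
  have hutSq_ss := hutSq.mul_const (s j * s k)
  calc ubbHat Q j k = ∫ z, ∫ x, z.1 * (x j * x k)
          ∂multivariateGaussian (WithLp.toLp 2 (z.2.1 • s + r)) (z.1⁻¹ • B) ∂Q :=
        h.integral_eq (f := fun p => p.1.2 * (p.2 j * p.2 k)) (by fun_prop) (by fun_prop)
          (by fun_prop) (hubb j k)
    _ = ∫ z, (B j k + z.1 * (r j * r k) + z.1 * z.2.1 * (s j * r k + r j * s k) +
          z.1 * z.2.1 ^ 2 * (s j * s k)) ∂Q := by
        refine integral_congr_ae ?_
        filter_upwards [hpos] with z hz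
        rw [integral_const_mul,
          integral_eval_mul_eval_multivariateGaussian _ (hB.smul (inv_pos.2 hz).le)]
        simp only [Pi.add_apply, Pi.smul_apply, smul_eq_mul, Matrix.smul_apply]
        field_simp
        ring
    _ = _ := by
        rw [integral_add (f := fun z => _ + _ + _) ((hconst.add hu_rr).add hut_sr) hutSq_ss,
          integral_add (f := fun z => _ + _) (hconst.add hu_rr) hut_sr,
          integral_add hconst hu_rr, integral_mul_const, integral_mul_const, integral_mul_const,
          integral_const, probReal_univ, one_smul]
        simp only [uHat, utHat, utSqHat, Matrix.add_apply, Matrix.smul_apply,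
          Matrix.vecMulVec_apply, smul_eq_mul]

end Normal

end ConditionalMoments

/-! ### Existence of the conditional moments -/

section NormalizedResiduals

theorem integral_sub_sq_multivariateGaussian {p : ℕ} (m : EuclideanSpace ℝ (Fin p))
    {S : Matrix (Fin p) (Fin p) ℝ} (hS : S.PosSemidef) (j : Fin p) :
    ∫ x, (x j - m j) ^ 2 ∂(multivariateGaussian m S) = S j j := by
  rw [← variance_eval_multivariateGaussian (μ := m) hS j, variance_eq_integral (by fun_prop),
    integral_eval_multivariateGaussian]

variable {Ω S E : Type*} [MeasurableSpace Ω] [MeasurableSpace S] [MeasurableSpace E]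
  [StandardBorelSpace E] [Nonempty E] {P : Measure Ω} [IsFiniteMeasure P]

theorem CondLaw.integrable_sq_of_integral_sq_eq {V : Ω → E} {W : Ω → S} {κ : S → Measure E}
    (hV : Measurable V) (hW : Measurable W) (h : CondLaw V W P κ) {g : S × E → ℝ}
    (hg : Measurable g) {C : ℝ}
    (hint : ∀ᵐ w ∂P.map W, Integrable (fun v => g (w, v) ^ 2) (κ w) ∧
      ∫ v, g (w, v) ^ 2 ∂κ w = C) :
    Integrable (fun ω => g (W ω, V ω) ^ 2) P :=
  h.integrable_of_nonneg hV hW (f := fun p => g p ^ 2) (by fun_prop) (fun _ => sq_nonneg _)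
    (hint.mono fun _ hw => hw.1)
    ((integrable_const C).congr (hint.mono fun _ hw => hw.2.symm))

theorem CondLaw.integrable_sq_truncNormal_residual {T U : Ω → ℝ} {c : ℝ} (hT : Measurable T)
    (hU : Measurable U) (hpos : ∀ᵐ u ∂P.map U, 0 < u)
    (h : CondLaw T U P fun u => truncNormal c u⁻¹ (Ioi c)) :
    Integrable (fun ω => (√(U ω) * (T ω - c)) ^ 2) P := by
  refine h.integrable_sq_of_integral_sq_eq hT hU (g := fun p => √p.1 * (p.2 - c)) (by fun_prop)
    (C := 1) ?_
  filter_upwards [hpos] with u hu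
  have := isProbabilityMeasure_truncNormal_Ioi c c (inv_pos.2 hu)
  have hi1 := integrable_pow_truncNormal_Ioi c c (inv_pos.2 hu) 1
  have hi2 := integrable_pow_truncNormal_Ioi c c (inv_pos.2 hu) 2
  have hi : Integrable (fun t => (t - c) ^ 2) (truncNormal c u⁻¹ (Ioi c)) := by
    refine ((hi2.sub (hi1.const_mul (2 * c))).add (integrable_const (c ^ 2))).congr
      (Filter.Eventually.of_forall fun t => ?_)
    simp only [Pi.add_apply, Pi.sub_apply]
    ring
  simp only [mul_pow, Real.sq_sqrt hu.le]
  refine ⟨hi.const_mul u, ?_⟩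
  rw [integral_const_mul, integral_sub_sq_truncNormal_Ioi c (inv_pos.2 hu), mul_inv_cancel₀ hu.ne']

theorem CondLaw.integrable_sq_multivariateGaussian_residual {p : ℕ}
    {V : Ω → EuclideanSpace ℝ (Fin p)} {W : Ω → S} {m : S → Fin p → ℝ} {u : S → ℝ}
    {C : Matrix (Fin p) (Fin p) ℝ} (hC : C.PosSemidef) (hV : Measurable V) (hW : Measurable W)
    (hm : Measurable m) (hu : Measurable u) (hpos : ∀ᵐ w ∂P.map W, 0 < u w)
    (h : CondLaw V W P fun w => multivariateGaussian (WithLp.toLp 2 (m w)) ((u w)⁻¹ • C))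
    (j : Fin p) : Integrable (fun ω => (√(u (W ω)) * (V ω j - m (W ω) j)) ^ 2) P := by
  refine h.integrable_sq_of_integral_sq_eq hV hW (g := fun p => √(u p.1) * (p.2 j - m p.1 j))
    (by fun_prop) (C := C j j) ?_
  filter_upwards [hpos] with w hw
  simp only [mul_pow, Real.sq_sqrt hw.le]
  have hi := (memLp_eval_multivariateGaussian (WithLp.toLp 2 (m w)) ((u w)⁻¹ • C) j).sub
    (memLp_const (m w j))
  refine ⟨hi.integrable_sq.const_mul _, ?_⟩
  rw [integral_const_mul,
    integral_sub_sq_multivariateGaussian (WithLp.toLp 2 (m w)) (hC.smul (inv_pos.2 hw).le),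
    Matrix.smul_apply, smul_eq_mul, mul_inv_cancel_left₀ hw.ne']

end NormalizedResiduals

theorem ae_memLp_two_condDistrib {Ω F G : Type*} [MeasurableSpace Ω] [MeasurableSpace F]
    [MeasurableSpace G] [StandardBorelSpace G] [Nonempty G] {P : Measure Ω} [IsFiniteMeasure P]
    {X : Ω → G} {Y : Ω → F} {f : F × G → ℝ} (hX : Measurable X) (hY : Measurable Y)
    (hf : Measurable f) (hint : Integrable (fun ω => f (Y ω, X ω) ^ 2) P) :
    ∀ᵐ y ∂(P.map Y), MemLp (fun x => f (y, x)) 2 (condDistrib X Y P y) := by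
  filter_upwards [ae_integrable_condDistrib (f := fun p => f p ^ 2) hX hY (by fun_prop) hint]
    with y hy
  exact (memLp_two_iff_integrable_sq
    (hf.comp measurable_prodMk_left).aestronglyMeasurable).2 hy

theorem integrable_mul_of_memLp_sqrt_mul {α : Type*} [MeasurableSpace α] {μ : Measure α}
    {u f g : α → ℝ} (hu : ∀ᵐ x ∂μ, 0 < u x) (hf : MemLp (fun x => √(u x) * f x) 2 μ)
    (hg : MemLp (fun x => √(u x) * g x) 2 μ) : Integrable (fun x => u x * (f x * g x)) μ := by
  refine (hf.integrable_mul hg).congr ?_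
  filter_upwards [hu] with x hx
  rw [Pi.mul_apply, mul_mul_mul_comm, Real.mul_self_sqrt hx.le]

theorem integrable_moments_of_memLp_sqrt_mul {q : ℕ}
    {Q : Measure (ℝ × ℝ × EuclideanSpace ℝ (Fin q))} (hpos : ∀ᵐ z ∂Q, 0 < z.1)
    (hU : MemLp (fun z => √z.1) 2 Q) (hT : MemLp (fun z => √z.1 * z.2.1) 2 Q)
    (hb : ∀ j, MemLp (fun z => √z.1 * z.2.2 j) 2 Q) :
    Integrable (fun z => z.1) Q ∧ Integrable (fun z => z.1 * z.2.1) Q ∧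
      Integrable (fun z => z.1 * z.2.1 ^ 2) Q ∧ (∀ j, Integrable (fun z => z.1 * z.2.2 j) Q) ∧
      (∀ j, Integrable (fun z => z.1 * z.2.1 * z.2.2 j) Q) ∧
      ∀ j k, Integrable (fun z => z.1 * (z.2.2 j * z.2.2 k)) Q := by
  have h_one : MemLp (fun z => √z.1 * 1) 2 Q := by simpa only [mul_one] using hU
  refine ⟨?_, ?_, ?_, fun j => ?_, fun j => ?_, fun j k =>
    integrable_mul_of_memLp_sqrt_mul hpos (hb j) (hb k)⟩
  · simpa only [mul_one] using integrable_mul_of_memLp_sqrt_mul hpos h_one h_one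
  · simpa only [mul_one] using integrable_mul_of_memLp_sqrt_mul hpos hT h_one
  · simpa only [sq] using integrable_mul_of_memLp_sqrt_mul hpos hT hT
  · simpa only [mul_one] using integrable_mul_of_memLp_sqrt_mul hpos (hb j) h_one
  · simpa only [mul_assoc] using integrable_mul_of_memLp_sqrt_mul hpos hT (hb j)

namespace SMSNLMM

variable {n l q : ℕ} {θ : SMSNLMM n l q}

variable (θ) in
theorem sub_loc_eq (y : Fin n → ℝ) (t : ℝ) (x : Fin q → ℝ) :
    y - θ.loc = (y - (θ.X *ᵥ θ.β + θ.Z *ᵥ x)) + θ.Z *ᵥ (x - t • θ.Delta) +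
      (t - θ.c) • (θ.Z *ᵥ θ.Delta) := by
  rw [loc, Matrix.mulVec_sub, Matrix.mulVec_smul, sub_smul]
  abel

theorem memLp_sqrt_mul_of_residuals {y : Fin n → ℝ} (hy : y ≠ θ.loc)
    {Q : Measure (ℝ × ℝ × EuclideanSpace ℝ (Fin q))}
    (hT : MemLp (fun z => √z.1 * (z.2.1 - θ.c)) 2 Q)
    (hb : ∀ j, MemLp (fun z => √z.1 * (z.2.2 j - (z.2.1 • θ.Delta) j)) 2 Q)
    (hY : ∀ i, MemLp (fun z => √z.1 * (y i - (θ.X *ᵥ θ.β + θ.Z *ᵥ z.2.2.ofLp) i)) 2 Q) :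
    MemLp (fun z => √z.1) 2 Q ∧ MemLp (fun z => √z.1 * z.2.1) 2 Q ∧
      ∀ j, MemLp (fun z => √z.1 * z.2.2 j) 2 Q := by
  obtain ⟨i, hi⟩ := Function.ne_iff.1 hy
  have hi' : y i - θ.loc i ≠ 0 := sub_ne_zero.2 hi
  have hU : MemLp (fun z => √z.1) 2 Q := by
    have hZb := memLp_finsetSum Finset.univ fun j _ => (hb j).const_mul (θ.Z i j)
    have hsum := ((hY i).add hZb).add (hT.const_mul ((θ.Z *ᵥ θ.Delta) i))
    refine (hsum.const_mul (y i - θ.loc i)⁻¹).ae_eq (Filter.Eventually.of_forall fun z => ?_)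
    have decomposition := congrFun (θ.sub_loc_eq y z.2.1 z.2.2.ofLp) i
    simp only [Pi.add_apply, Pi.sub_apply, Pi.smul_apply, smul_eq_mul, Matrix.mulVec, dotProduct,
      mul_left_comm _ √_, ← Finset.mul_sum] at decomposition ⊢
    rw [← mul_add, mul_comm (Finset.sum _ _), ← mul_add, inv_mul_eq_div, div_eq_iff hi',
      decomposition]
  have hUT : MemLp (fun z => √z.1 * z.2.1) 2 Q :=
    (hT.add (hU.const_mul θ.c)).ae_eq
      (Filter.Eventually.of_forall fun z => by simp only [Pi.add_apply]; ring)
  refine ⟨hU, hUT, fun j => ((hb j).add (hUT.const_mul (θ.Delta j))).ae_eq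
    (Filter.Eventually.of_forall fun z => ?_)⟩
  simp only [Pi.add_apply, Pi.smul_apply, smul_eq_mul]
  ring

namespace IsModel

variable {Ω : Type*} [MeasurableSpace Ω] {P : Measure Ω} [IsProbabilityMeasure P]
  {U T : Ω → ℝ} {b : Ω → EuclideanSpace ℝ (Fin q)} {Y : Ω → EuclideanSpace ℝ (Fin n)}

theorem ae_condLatent_pos (h : θ.IsModel P U T b Y) :
    ∀ᵐ y ∂P.map Y, ∀ᵐ z ∂condLatent P U T b Y y, 0 < z.1 := by
  obtain ⟨hU, hT, hb, hY, -⟩ := id h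
  have latent_measurable : Measurable fun ω => (U ω, T ω, b ω) := by fun_prop
  have measurableSet_pos : MeasurableSet {z : ℝ × ℝ × EuclideanSpace ℝ (Fin q) | 0 < z.1} :=
    measurable_fst measurableSet_Ioi
  exact (ae_condDistrib_of_ae latent_measurable hY measurableSet_pos h.ae_U_pos :)

theorem ae_ne_loc (h : θ.IsModel P U T b Y) (hn : 0 < n) : ∀ᵐ y ∂P.map Y, y.ofLp ≠ θ.loc := by
  have : Nonempty (Fin n) := ⟨⟨0, hn⟩⟩
  have absolutelyContinuous : P.map Y ≪ volume := by
    rw [h.map_Y]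
    exact withDensity_absolutelyContinuous _ _
  filter_upwards [absolutelyContinuous.ae_le (Measure.ae_ne volume (WithLp.toLp 2 θ.loc))] with y hy
  exact fun h_eq => hy (by rw [← h_eq])

theorem integrable_sq_residual_b (h : θ.IsModel P U T b Y) (j : Fin q) :
    Integrable (fun ω => (√(U ω) * (b ω j - (T ω • θ.Delta) j)) ^ 2) P := by
  obtain ⟨hU, hT, hb, -, -, -, law_b, -⟩ := id h
  have pos : ∀ᵐ w ∂P.map (fun ω => (T ω, U ω)), 0 < w.2 :=
    (h.ae_map_inv_pos (by fun_prop) measurable_snd fun _ => rfl).mono fun _ => inv_pos.1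
  exact law_b.integrable_sq_multivariateGaussian_residual θ.Gam_posDef.posSemidef hb
    (by fun_prop) (by fun_prop) (by fun_prop) pos j

theorem integrable_sq_residual_Y (h : θ.IsModel P U T b Y) (i : Fin n) :
    Integrable (fun ω => (√(U ω) * (Y ω i - (θ.X *ᵥ θ.β + θ.Z *ᵥ (b ω).ofLp) i)) ^ 2) P := by
  obtain ⟨hU, hT, hb, hY, -, -, -, law_Y⟩ := id h
  have pos : ∀ᵐ w ∂P.map (fun ω => (b ω, T ω, U ω)), 0 < w.2.2 :=
    (h.ae_map_inv_pos (by fun_prop) (measurable_snd.comp measurable_snd) fun _ => rfl).mono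
      fun _ => inv_pos.1
  exact law_Y.integrable_sq_multivariateGaussian_residual θ.Sig_posDef.posSemidef hY
    (by fun_prop) (measurable_const.add (measurable_mulVec θ.Z (by fun_prop))) (by fun_prop) pos i

theorem ae_condLatent_memLp (h : θ.IsModel P U T b Y) (hn : 0 < n) : ∀ᵐ y ∂P.map Y,
    MemLp (fun z => √z.1) 2 (condLatent P U T b Y y) ∧
      MemLp (fun z => √z.1 * z.2.1) 2 (condLatent P U T b Y y) ∧
      ∀ j, MemLp (fun z => √z.1 * z.2.2 j) 2 (condLatent P U T b Y y) := by
  obtain ⟨hU, hT, hb, hY, law_U, law_T, -⟩ := id h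
  have latent_measurable : Measurable fun ω => (U ω, T ω, b ω) := by fun_prop
  have memLp_T : ∀ᵐ y ∂P.map Y,
      MemLp (fun z => √z.1 * (z.2.1 - θ.c)) 2 (condLatent P U T b Y y) :=
    (ae_memLp_two_condDistrib (f := fun p => √p.2.1 * (p.2.2.1 - θ.c)) latent_measurable hY
      (by fun_prop)
      (law_T.integrable_sq_truncNormal_residual hT hU (law_U ▸ θ.H_pos)) :)
  have memLp_b : ∀ᵐ y ∂P.map Y, ∀ j,
      MemLp (fun z => √z.1 * (z.2.2 j - (z.2.1 • θ.Delta) j)) 2 (condLatent P U T b Y y) :=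
    ae_all_iff.2 fun j => (ae_memLp_two_condDistrib
      (f := fun p => √p.2.1 * (p.2.2.2 j - (p.2.2.1 • θ.Delta) j)) latent_measurable hY
      (by fun_prop) (h.integrable_sq_residual_b j) :)
  have memLp_Y : ∀ᵐ y ∂P.map Y, ∀ i,
      MemLp (fun z => √z.1 * (y i - (θ.X *ᵥ θ.β + θ.Z *ᵥ z.2.2.ofLp) i)) 2
        (condLatent P U T b Y y) :=
    ae_all_iff.2 fun i => (ae_memLp_two_condDistrib
      (f := fun p => √p.2.1 * (p.1.ofLp i - (θ.X *ᵥ θ.β + θ.Z *ᵥ p.2.2.2.ofLp) i))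
      latent_measurable hY (by fun_prop) (h.integrable_sq_residual_Y i) :)
  filter_upwards [h.ae_ne_loc hn, memLp_T, memLp_b, memLp_Y] with y hy hTy hby hYy
  exact memLp_sqrt_mul_of_residuals hy hTy hby hYy

end IsModel

end SMSNLMM

theorem mainTheorem3 {n l q : ℕ} (hn : 0 < n) (θ : SMSNLMM n l q)
    {Ω : Type*} [MeasurableSpace Ω] (P : Measure Ω) [IsProbabilityMeasure P]
    (U T : Ω → ℝ) (b : Ω → EuclideanSpace ℝ (Fin q)) (Y : Ω → EuclideanSpace ℝ (Fin n))
    (h : θ.IsModel P U T b Y) :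
    -- conditional distribution of `b` given `T`, `U`, `Y`
    CondLaw b (fun ω => (T ω, U ω, Y ω)) P (fun w =>
      multivariateGaussian (WithLp.toLp 2 (w.1 • θ.s + θ.r w.2.2.ofLp)) (w.2.1⁻¹ • θ.B)) ∧
    -- conditional distribution of `T` given `U`, `Y`
    CondLaw T (fun ω => (U ω, Y ω)) P (fun w =>
      truncNormal (θ.c + θ.mu w.2.ofLp) (w.1⁻¹ * θ.M ^ 2) (Ioi θ.c)) ∧
    -- marginal distribution of `Y`
    P.map Y = smsn θ.loc θ.Psi θ.lamBar θ.H ∧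
    -- the two expressions of `A`
    (∀ y : Fin n → ℝ,
      θ.A y = θ.lamBar ⬝ᵥ ((CFC.sqrt θ.Psi)⁻¹ *ᵥ (y - θ.loc))) ∧
    -- conditional moments given `Y = y`
    ∀ᵐ y ∂(P.map Y), ∀ Q : Measure (ℝ × ℝ × EuclideanSpace ℝ (Fin q)),
      Q = condLatent P U T b Y y →
      -- they exist
      (Integrable (fun z => z.1) Q ∧
        Integrable (fun z => z.1 * z.2.1) Q ∧
        Integrable (fun z => z.1 * z.2.1 ^ 2) Q ∧
        (∀ j, Integrable (fun z => z.1 * z.2.2 j) Q) ∧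
        (∀ j, Integrable (fun z => z.1 * z.2.1 * z.2.2 j) Q) ∧
        (∀ j k, Integrable (fun z => z.1 * (z.2.2 j * z.2.2 k)) Q) ∧
        Integrable (fun z => Real.sqrt z.1 * WPhi (Real.sqrt z.1 * θ.A y.ofLp)) Q) ∧
      -- and are given by
      utHat Q = (θ.mu y.ofLp + θ.c) * uHat Q + θ.M * tauOneHat Q (θ.A y.ofLp) ∧
      utSqHat Q = θ.M ^ 2 + (θ.mu y.ofLp + θ.c) ^ 2 * uHat Q +
        θ.M * (θ.mu y.ofLp + 2 * θ.c) * tauOneHat Q (θ.A y.ofLp) ∧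
      ubHat Q = uHat Q • θ.r y.ofLp + utHat Q • θ.s ∧
      utbHat Q = utHat Q • θ.r y.ofLp + utSqHat Q • θ.s ∧
      ubbHat Q = θ.B + uHat Q • Matrix.vecMulVec (θ.r y.ofLp) (θ.r y.ofLp) +
        utHat Q • (Matrix.vecMulVec θ.s (θ.r y.ofLp) + Matrix.vecMulVec (θ.r y.ofLp) θ.s) +
        utSqHat Q • Matrix.vecMulVec θ.s θ.s := by
  refine ⟨h.condLaw_b_of_T_U_Y.comp_measurableEquiv MeasurableEquiv.prodAssoc h.measurable_b
    ((h.measurable_T.prodMk h.measurable_U).prodMk h.measurable_Y), h.condLaw_T_of_U_Y, h.map_Y,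
    θ.A_eq, ?_⟩
  filter_upwards [h.ae_condLatent_pos, h.ae_condLatent_condLaw_T, h.ae_condLatent_condLaw_b,
    h.ae_condLatent_memLp hn] with y hpos law_T law_b hL2
  rintro Q rfl
  obtain ⟨hu, hut, hutSq, hub, hutb, hubb⟩ :=
    integrable_moments_of_memLp_sqrt_mul hpos hL2.1 hL2.2.1 hL2.2.2
  exact ⟨⟨hu, hut, hutSq, hub, hutb, hubb, integrable_sqrt_mul_WPhi θ.M_pos hpos law_T hu hut⟩,
    utHat_eq_of_condLaw_truncNormal θ.M_pos hpos law_T hu hut,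
    utSqHat_eq_of_condLaw_truncNormal θ.M_pos hpos law_T hu hut hutSq,
    ubHat_eq_of_condLaw_multivariateGaussian law_b hu hut hub,
    utbHat_eq_of_condLaw_multivariateGaussian law_b hut hutSq hutb,
    ubbHat_eq_of_condLaw_multivariateGaussian θ.B_posDef.posSemidef hpos law_b hu hut hutSq hubb⟩
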